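/- Let $n,k\ge 1$ be integers. A cake cutting instance with $n$ players consists of continuous non-negative densities $d_1,\dots,d_n$ on the cake $[0,1]$ with $\int_0^1 d_i=1$; player $i$ values $S\subseteq[0,1]$ at $V_i(S)=\int_S d_i$. Let $I(n)$ be the set of these instances. For $j\ge1$, $\mathrm{Allocations}_f(j)(I)$ is the set of all families $(A_1,\dots,A_n)$ of pairwise disjoint portions, each a union of at most $j$ disjoint intervals of $[0,1]$ (possibly empty), that are envy-free: $V_i(A_i)\ge V_i(A_l)$ for all $i,l$. The egalitarian welfare of $A$ is $\mathrm{EW}(A)=\min_i V_i(A_i)$. Put $$\tau(I)=\frac{\max_{A\in \mathrm{Allocations}_f(k)(I)}\mathrm{EW}(A)}{\max_{A\in \mathrm{Allocations}_f(1)(I)}\mathrm{EW}(A)},\qquad POIE_f(n,k)=\sup_{I\in I(n)}\tau(I).$$ **Theorem 3.22 (POIE with fairness).** For every instance, both maxima exist and the denominator is positive; the supremum is finite; and $$POIE_f(n,k)\ \begin{cases}\ \ge k & \text{if } k\le n,\\ \ =n & \text{if } k>n.\end{cases}$$ Moreover, some instance $I\in I(n)$ has $\tau(I)\ge k$ if $k\le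 n$, and some instance has $\tau(I)=n$ if $k>n$. All this holds both if the whole cake has to be allocated, $\bigcup_i A_i=[0,1]$, and if part of it may be left unallocated. -/

import Mathlib

open MeasureTheory

noncomputable section

namespace CakeCutting

/-- A cake cutting instance with `n` players: the cake is the interval `[0,1]`, and every player
has a continuous, non-negative value density on the cake of total value `1`. -/
structure Instance (n : ℕ) where
  density : Fin n → ℝ → ℝ
  continuousOn : ∀ i, ContinuousOn (density i) (Set.Icc 0 1)
  nonneg : ∀ i, ∀ x ∈ Set.Icc (0 : ℝ) 1, 0 ≤ density i x
  normalized : ∀ i, ∫ x in Set.Icc (0 : ℝ) 1, density i x = 1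

/-- The value `V_i(S)` of the part `S` of the cake to player `i`. -/
def Instance.value {n : ℕ} (I : Instance n) (i : Fin n) (S : Set ℝ) : ℝ :=
  ∫ x in S, I.density i x

/-- `S` is a union of at most `k` pairwise disjoint intervals of the cake. The order-connected
subsets of `ℝ` are exactly the intervals (open, closed or half-open, possibly degenerate);
empty ones are allowed, which gives "at most". -/
def IsPortion (k : ℕ) (S : Set ℝ) : Prop :=
  ∃ J : Fin k → Set ℝ,
    (∀ m, (J m).OrdConnected ∧ J m ⊆ Set.Icc 0 1) ∧
    (∀ m m', m ≠ m' → Disjoint (J m) (J m')) ∧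
    S = ⋃ m, J m

/-- `A` is an allocation giving each of the `n` players at most `k` disjoint pieces. If
`freeDisposal` is `true`, parts of the cake may be left unallocated; if it is `false`, the whole
cake has to be allocated. -/
structure IsAllocation (freeDisposal : Bool) {n : ℕ} (k : ℕ) (A : Fin n → Set ℝ) : Prop where
  portion : ∀ i, IsPortion k (A i)
  disjoint : ∀ i j, i ≠ j → Disjoint (A i) (A j)
  whole : freeDisposal = false → ⋃ i, A i = Set.Icc 0 1

/-- No player prefers the portion of another player to their own. -/
def Instance.EnvyFree {n : ℕ} (I : Instance n) (A : Fin n → Set ℝ) : Prop :=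
  ∀ i j, I.value i (A j) ≤ I.value i (A i)

/-- The set of envy-free allocations with at most `k` disjoint pieces per player. -/
def Instance.allocationsF {n : ℕ} (I : Instance n) (freeDisposal : Bool) (k : ℕ) :
    Set (Fin n → Set ℝ) :=
  {A | IsAllocation freeDisposal k A ∧ I.EnvyFree A}

/-- Egalitarian welfare: the smallest utility of a player. -/
def Instance.egalitarianWelfare {n : ℕ} (I : Instance n) (A : Fin n → Set ℝ) : ℝ :=
  ⨅ i, I.value i (A i)

/-- The optimal egalitarian welfare over envy-free allocations with at most `k` pieces each. -/
def Instance.optEgalitarianF {n : ℕ} (I : Instance n) (freeDisposal : Bool) (k : ℕ) : ℝ :=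
  sSup (I.egalitarianWelfare '' I.allocationsF freeDisposal k)

/-- The gain in optimal egalitarian welfare, subject to envy-freeness, when each player may get
up to `k` pieces instead of one. -/
def Instance.gainEF {n : ℕ} (I : Instance n) (freeDisposal : Bool) (k : ℕ) : ℝ :=
  I.optEgalitarianF freeDisposal k / I.optEgalitarianF freeDisposal 1

/-- The egalitarian price of indivisibility with envy-freeness: the supremum of the gain over all
instances with `n` players. -/
def POIEf (freeDisposal : Bool) (n k : ℕ) : ℝ :=
  ⨆ I : Instance n, I.gainEF freeDisposal k

end CakeCutting

end

/-!
Envy-freeness in a division of the whole cake gives every player at least `1 / n`, while no welfare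
exceeds `1`, so gains are at most `n` once envy-free divisions into intervals exist. For these,
apply the Knaster–Kuratowski–Mazurkiewicz lemma to the simplex of cuts: let every player spread a
unit weight continuously over the pieces that are almost best for them, and find a cut where no
piece receives more than weight `1` in total; Hall's theorem then assigns to each player an almost
best piece, and compactness an actual best one. The KKM lemma itself is obtained on a fine grid from
Scarf's parity argument, which needs no triangulation. Optimal allocations exist because values
depend continuously on the endpoints of the pieces, which range over a compact set.

For a gain of `m ≤ min n k`, let player `0` value `m` intervals equally, separated by the intervals
which other players desire exclusively. With `m` pieces everyone obtains everything they value, but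
one piece worth more than `1 / m` to player `0` leaves another player with nothing.
-/

noncomputable section

namespace CakeCutting

open Finset

/-! ### Rainbow dominant sets -/

section Dominant

variable {X ι α β : Type*}

theorem card_filter_image_erase_eq_two [DecidableEq X] [DecidableEq β] {f : X → β}
    {s : Finset X} (h : #s = #(s.image f) + 1) :
    #{a ∈ s | (s.erase a).image f = s.image f} = 2 := by
  obtain ⟨x, hx, y, hy, hxy, hf⟩ := exists_ne_map_eq_of_card_lt_of_maps_to
    (t := s.image f) (by omega) fun a ha => mem_image_of_mem f ha
  have himage : ∀ {a b}, b ∈ s.erase a → f a = f b → (s.erase a).image f = s.image f := by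
    refine fun {a b} hb hab => (image_subset_image (erase_subset _ _)).antisymm fun z hz => ?_
    obtain ⟨c, hc, rfl⟩ := mem_image.1 hz
    obtain rfl | hca := eq_or_ne c a
    · exact hab ▸ mem_image_of_mem f hb
    · exact mem_image_of_mem f (mem_erase.2 ⟨hca, hc⟩)
  have hxy_image := himage (mem_erase.2 ⟨hxy.symm, hy⟩) hf
  have hinj : Set.InjOn f (s.erase x : Finset X) := by
    rw [← card_image_iff, hxy_image, card_erase_of_mem hx, h, Nat.add_sub_cancel]
  refine card_eq_two.2 ⟨x, y, hxy, subset_antisymm (fun a ha => ?_) ?_⟩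
  · obtain ⟨has, ha⟩ := mem_filter.1 ha
    obtain ⟨b, hb, hba⟩ := mem_image.1 (ha ▸ mem_image_of_mem f has)
    obtain ⟨hne, hbs⟩ := mem_erase.1 hb
    by_contra hnot
    simp only [mem_insert, mem_singleton, not_or] at hnot
    have hax : a ∈ s.erase x := mem_erase.2 ⟨hnot.1, has⟩
    obtain rfl | hbx := eq_or_ne b x
    · exact hnot.2 (hinj hax (mem_erase.2 ⟨hxy.symm, hy⟩) (hba.symm.trans hf))
    · exact hne (hinj (mem_erase.2 ⟨hbx, hbs⟩) hax hba)
  · rintro a ha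
    obtain rfl | rfl := by simpa using ha
    · exact mem_filter.2 ⟨hx, hxy_image⟩
    · exact mem_filter.2 ⟨hy, himage (mem_erase.2 ⟨hxy, hx⟩) hf.symm⟩

theorem image_eq_univ_of_odd_card_filter_image_erase [DecidableEq X] [Fintype ι] [DecidableEq ι]
    {c : X → ι} {i₀ : ι} {σ : Finset X} (hcard : #σ = Fintype.card ι)
    (hodd : Odd #{x ∈ σ | (σ.erase x).image c = univ.erase i₀}) : σ.image c = univ := by
  by_contra hnot
  obtain ⟨x, hx⟩ := card_pos.1 hodd.pos
  obtain ⟨hxσ, hx⟩ := mem_filter.1 hx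
  have himage : σ.image c = univ.erase i₀ := by
    have hsub : univ.erase i₀ ⊆ σ.image c := hx ▸ image_subset_image (erase_subset _ _)
    by_contra hne
    refine hnot (eq_univ_of_card _ (le_antisymm (card_le_univ _) ?_))
    have := card_lt_card (hsub.ssubset_of_ne (Ne.symm hne))
    rw [card_erase_of_mem (mem_univ _), card_univ] at this
    omega
  rw [← himage, card_filter_image_erase_eq_two] at hodd
  · exact absurd hodd (by decide)
  · rw [himage, card_erase_add_one (mem_univ _), card_univ, hcard]

theorem sum_card_filter_erase_eq_sum_card_filter_insert [Fintype X] [DecidableEq X]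
    {P Q : Finset X → Prop} [DecidablePred P] [DecidablePred Q]
    (hP : ∀ σ τ, τ ⊆ σ → P σ → P τ) (n : ℕ) :
    ∑ σ with #σ = n ∧ P σ, #{x ∈ σ | Q (σ.erase x)} =
      ∑ τ with (#τ + 1 = n ∧ P τ) ∧ Q τ, #{x | x ∉ τ ∧ P (insert x τ)} := by
  rw [← card_sigma, ← card_sigma]
  refine card_nbij' (fun p => ⟨p.1.erase p.2, p.2⟩) (fun p => ⟨insert p.2 p.1, p.2⟩) ?_ ?_ ?_ ?_ <;>
    rintro ⟨σ, x⟩ h <;>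
    simp only [coe_sigma, Set.mem_sigma_iff, mem_coe, mem_filter, mem_univ, true_and] at h ⊢
  · obtain ⟨⟨hcard, hPσ⟩, hx, hQ⟩ := h
    exact ⟨⟨⟨(card_erase_add_one hx).trans hcard, hP _ _ (erase_subset _ _) hPσ⟩, hQ⟩,
      notMem_erase _ _, by rwa [insert_erase hx]⟩
  · obtain ⟨⟨⟨hcard, -⟩, hQ⟩, hx, hPσ⟩ := h
    exact ⟨⟨(card_insert_of_notMem hx).trans hcard, hPσ⟩, mem_insert_self _ _,
      by rwa [erase_insert hx]⟩
  · rw [insert_erase h.2.1]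
  · rw [erase_insert h.2.1]

variable [LinearOrder α]

/-- Scarf's notion of a dominant set for a family of rankings `r i`: no element is ranked strictly
above the worst element of `σ` by all of the `r i`. -/
def Dominant (r : ι → X → α) (σ : Finset X) : Prop :=
  ∀ y, ∃ i, ∀ x ∈ σ, r i y ≤ r i x

/-- `m i` is a worst element of `τ` for the ranking `r i`. -/
structure IsWorst (r : ι → X → α) (τ : Finset X) (m : ι → X) : Prop where
  mem : ∀ i, m i ∈ τ
  le : ∀ i, ∀ x ∈ τ, r i (m i) ≤ r i x

/-- `x` is the element Scarf's pivoting step adds to a set with worst elements `m` once the ranking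
`a` has become redundant: the best one for `r a` among those beating the worst elements for all
other rankings. -/
def IsPivot (r : ι → X → α) (m : ι → X) (a : ι) (x : X) : Prop :=
  (∀ i ≠ a, r i (m i) < r i x) ∧ ∀ y, (∀ i ≠ a, r i (m i) < r i y) → r a y ≤ r a x

variable {r : ι → X → α} {σ τ : Finset X} {m : ι → X} {a a' : ι} {x x' : X}

theorem Dominant.mono (h : Dominant r σ) (hτ : τ ⊆ σ) : Dominant r τ := fun y =>
  (h y).imp fun _ hi x hx => hi x (hτ hx)

theorem exists_isWorst (hτ : τ.Nonempty) : ∃ m, IsWorst r τ m := by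
  choose m hm hle using fun i => τ.exists_min_image (r i) hτ
  exact ⟨m, hm, hle⟩

theorem IsWorst.eq (hm : IsWorst r τ m) (hr : ∀ i, (r i).Injective) {i : ι} (hx : x ∈ τ)
    (h : ∀ y ∈ τ, r i x ≤ r i y) : m i = x :=
  hr i ((hm.le i x hx).antisymm (h _ (hm.mem i)))

theorem IsPivot.eq (hr : ∀ i, (r i).Injective) (hx : IsPivot r m a x) (hx' : IsPivot r m a x') :
    x = x' :=
  hr a ((hx'.2 x hx.1).antisymm (hx.2 x' hx'.1))

theorem exists_isPivot [Finite X] (h : ∃ y, ∀ i ≠ a, r i (m i) < r i y) : ∃ x, IsPivot r m a x :=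
  Set.exists_max_image {y | ∀ i ≠ a, r i (m i) < r i y} (r a) (Set.toFinite _) h

theorem IsPivot.le_worst (hτ : Dominant r τ) (hm : IsWorst r τ m) (hx : IsPivot r m a x) :
    r a x ≤ r a (m a) := by
  obtain ⟨i, hi⟩ := hτ x
  obtain rfl : i = a := by_contra fun hia => (hx.1 i hia).not_ge (hi _ (hm.mem i))
  exact hi _ (hm.mem i)

theorem IsPivot.index_eq (hτ : Dominant r τ) (hm : IsWorst r τ m) (hx : IsPivot r m a x)
    (hx' : IsPivot r m a' x) : a = a' :=
  by_contra fun h => (hx'.1 a h).not_ge (hx.le_worst hτ hm)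

variable [DecidableEq X]

theorem IsPivot.dominant_insert (hτ : Dominant r τ) (hm : IsWorst r τ m) (hx : IsPivot r m a x) :
    Dominant r (insert x τ) := by
  intro y
  by_cases hy : ∀ i ≠ a, r i (m i) < r i y
  · have hyx : r a y ≤ r a x := hx.2 y hy
    exact ⟨a, forall_mem_insert _ _ _ |>.2
      ⟨hyx, fun z hz => (hyx.trans (hx.le_worst hτ hm)).trans (hm.le a z hz)⟩⟩
  · push Not at hy
    obtain ⟨i, hia, hi⟩ := hy
    exact ⟨i, forall_mem_insert _ _ _ |>.2
      ⟨hi.trans (hx.1 i hia).le, fun z hz => hi.trans (hm.le i z hz)⟩⟩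

variable [Fintype ι]

theorem IsWorst.image_eq (hm : IsWorst r τ m) (hr : ∀ i, (r i).Injective) (hτ : Dominant r τ) :
    univ.image m = τ :=
  (image_subset_iff.2 fun i _ => hm.mem i).antisymm fun x hx =>
    let ⟨i, hi⟩ := hτ x
    mem_image.2 ⟨i, mem_univ i, hm.eq hr hx hi⟩

theorem IsWorst.exists_isPivot_of_dominant_insert [DecidableEq ι] (hm : IsWorst r τ m)
    (hr : ∀ i, (r i).Injective) (hcard : #τ + 1 = Fintype.card ι) (hxτ : x ∉ τ)
    (hx : Dominant r (insert x τ)) : ∃ a, (univ.erase a).image m = τ ∧ IsPivot r m a x := by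
  obtain ⟨a, ha⟩ := hx x
  have hworst : ∀ t ∈ τ, ∃ i ≠ a, m i = t ∧ r i t < r i x := by
    intro t ht
    obtain ⟨i, hi⟩ := hx t
    have hlt : r i t < r i x := (hi x (mem_insert_self _ _)).lt_of_ne fun h => hxτ (hr i h ▸ ht)
    refine ⟨i, ?_, hm.eq hr ht fun y hy => hi y (mem_insert_of_mem hy), hlt⟩
    rintro rfl
    exact hlt.not_ge (ha t (mem_insert_of_mem ht))
  have himage : (univ.erase a).image m = τ :=
    (image_subset_iff.2 fun i _ => hm.mem i).antisymm fun t ht =>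
      let ⟨i, hi, hmi, _⟩ := hworst t ht
      mem_image.2 ⟨i, mem_erase.2 ⟨hi, mem_univ i⟩, hmi⟩
  have hinj : Set.InjOn m (univ.erase a : Finset ι) := by
    rw [← card_image_iff, himage, card_erase_of_mem (mem_univ a), card_univ, ← hcard,
      Nat.add_sub_cancel]
  refine ⟨a, himage, fun i hi => ?_, fun y hy => ?_⟩
  · obtain ⟨j, hj, hji, hlt⟩ := hworst (m i) (hm.mem i)
    rwa [hinj (by simpa using hj) (by simpa using hi) hji] at hlt
  · obtain ⟨i, hi⟩ := hx y
    obtain rfl : i = a :=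
      by_contra fun hia => (hy i hia).not_ge (hi _ (mem_insert_of_mem (hm.mem i)))
    exact hi x (mem_insert_self _ _)

theorem IsWorst.notMem_and_dominant_insert_iff [DecidableEq ι] (hm : IsWorst r τ m)
    (hr : ∀ i, (r i).Injective) (hcard : #τ + 1 = Fintype.card ι) (hτ : Dominant r τ) :
    x ∉ τ ∧ Dominant r (insert x τ) ↔ ∃ a, (univ.erase a).image m = τ ∧ IsPivot r m a x := by
  refine ⟨fun h => hm.exists_isPivot_of_dominant_insert hr hcard h.1 h.2, ?_⟩
  rintro ⟨a, himage, hx⟩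
  refine ⟨fun hxτ => ?_, hx.dominant_insert hτ hm⟩
  obtain ⟨i, hi, rfl⟩ := mem_image.1 (himage ▸ hxτ)
  exact (hx.1 i (ne_of_mem_erase hi)).false

open Classical in
theorem Dominant.card_extensions_eq_two [Fintype X] (hr : ∀ i, (r i).Injective)
    (hcard : #τ + 1 = Fintype.card ι) (hne : τ.Nonempty) (hτ : Dominant r τ)
    (habove : ∀ a, ∃ y, ∀ i ≠ a, ∃ x ∈ τ, r i x < r i y) :
    #{x | x ∉ τ ∧ Dominant r (insert x τ)} = 2 := by
  obtain ⟨m, hm⟩ := exists_isWorst (r := r) hne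
  have hpivot : ∀ a, ∃ x, IsPivot r m a x := fun a => exists_isPivot <|
    (habove a).imp fun y hy i hi =>
      let ⟨x, hx, hxy⟩ := hy i hi
      (hm.le i x hx).trans_lt hxy
  choose e he using hpivot
  have hinj : e.Injective := fun a a' h => (he a).index_eq hτ hm (h ▸ he a')
  have himage : univ.image m = τ := hm.image_eq hr hτ
  calc #{x | x ∉ τ ∧ Dominant r (insert x τ)}
      = #(image e {a | (univ.erase a).image m = univ.image m}) := by
        congr 1
        ext x
        simp only [mem_filter, mem_univ, true_and, mem_image, himage,
          hm.notMem_and_dominant_insert_iff hr hcard hτ]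
        exact exists_congr fun a => and_congr_right fun _ =>
          ⟨fun hx => (he a).eq hr hx, fun hx => hx ▸ he a⟩
    _ = #{a | (univ.erase a).image m = univ.image m} := card_image_of_injective _ hinj
    _ = 2 := card_filter_image_erase_eq_two (by rw [card_univ, himage, hcard])

end Dominant

section Slack

variable {T ι α : Type*} [LinearOrder α]

/-- Rankings of `T` with a slack element added for each ranking, which is worst in its own ranking
and beats `T` in all others. -/
structure IsSlackRanking (r : ι → T ⊕ ι → α) : Prop where
  injective : ∀ i, (r i).Injective
  slack_lt : ∀ i t, r i (.inr i) < r i (.inl t)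
  lt_slack : ∀ i j t, j ≠ i → r i (.inl t) < r i (.inr j)

variable {r : ι → T ⊕ ι → α} {i₀ : ι}

theorem IsSlackRanking.slack_le (hr : IsSlackRanking r) (t : T) (i : ι) :
    ∀ x, r i (.inr i) ≤ r i x
  | .inl s => (hr.slack_lt i s).le
  | .inr j => by
    obtain rfl | hij := eq_or_ne j i
    · exact le_rfl
    · exact ((hr.slack_lt i t).trans (hr.lt_slack i j t hij)).le

variable [DecidableEq T] [Fintype ι] [DecidableEq ι]

/-- The set of all slack elements except the one of `i₀`: the facet at which the parity argument
starts. -/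
def slackFacet (T : Type*) [DecidableEq T] (i₀ : ι) : Finset (T ⊕ ι) :=
  (univ.erase i₀).image .inr

theorem inl_notMem_slackFacet {t : T} : .inl t ∉ slackFacet T i₀ := by
  simp [slackFacet]

theorem inr_mem_slackFacet_iff {j : ι} : .inr j ∈ slackFacet T i₀ ↔ j ≠ i₀ := by
  simp [slackFacet]

theorem card_slackFacet_add_one : #(slackFacet T i₀) + 1 = Fintype.card ι := by
  rw [slackFacet, card_image_of_injective _ Sum.inr_injective, card_erase_add_one (mem_univ _),
    card_univ]

theorem IsSlackRanking.dominant_insert_slackFacet_iff (hr : IsSlackRanking r) {t : T} :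
    Dominant r (insert (.inl t) (slackFacet T i₀)) ↔ ∀ s, r i₀ (.inl s) ≤ r i₀ (.inl t) := by
  refine ⟨fun h s => ?_, fun ht y => ?_⟩
  · obtain ⟨i, hi⟩ := h (.inl s)
    obtain rfl : i = i₀ := by_contra fun hne => (hr.slack_lt i s).not_ge <|
      hi _ (mem_insert_of_mem (inr_mem_slackFacet_iff.2 hne))
    exact hi _ (mem_insert_self _ _)
  · obtain s | j := y
    · refine ⟨i₀, forall_mem_insert _ _ _ |>.2 ⟨ht s, ?_⟩⟩
      rintro (w | j) hx
      · exact absurd hx inl_notMem_slackFacet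
      · exact (hr.lt_slack i₀ j s (inr_mem_slackFacet_iff.1 hx)).le
    · exact ⟨j, fun x _ => hr.slack_le t j x⟩

theorem IsSlackRanking.not_dominant_insert_inr (hr : IsSlackRanking r) (t : T) :
    ¬ Dominant r (insert (.inr i₀) (slackFacet T i₀)) := by
  intro h
  obtain ⟨i, hi⟩ := h (.inl t)
  refine (hr.slack_lt i t).not_ge (hi _ ?_)
  rw [mem_insert, inr_mem_slackFacet_iff, Sum.inr.injEq]
  exact em _

open Classical in
theorem IsSlackRanking.card_extensions_slackFacet [Fintype T] [Nonempty T]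
    (hr : IsSlackRanking r) :
    #{x | x ∉ slackFacet T i₀ ∧ Dominant r (insert x (slackFacet T i₀))} = 1 := by
  obtain ⟨w, hw⟩ := Finite.exists_max fun t => r i₀ (.inl t)
  refine card_eq_one.2 ⟨.inl w, ext fun x => ?_⟩
  rw [mem_filter_univ, mem_singleton]
  obtain t | j := x
  · rw [hr.dominant_insert_slackFacet_iff]
    exact ⟨fun h => hr.injective i₀ ((hw t).antisymm (h.2 w)),
      fun h => h ▸ ⟨inl_notMem_slackFacet, hw⟩⟩
  · rw [inr_mem_slackFacet_iff, not_not]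
    refine iff_of_false ?_ Sum.inr_ne_inl
    rintro ⟨rfl, h⟩
    exact hr.not_dominant_insert_inr w h

theorem eq_slackFacet_of_forall_inl_notMem {c : T → ι} {τ : Finset (T ⊕ ι)}
    (hτ : ∀ t, .inl t ∉ τ) (himage : τ.image (Sum.elim c id) = univ.erase i₀) :
    τ = slackFacet T i₀ := by
  ext (t | j)
  · exact iff_of_false (hτ t) inl_notMem_slackFacet
  · have hj := Finset.ext_iff.1 himage j
    simp only [mem_image, Sum.exists, hτ, Sum.elim_inr, id, false_and, exists_false, false_or,
      exists_eq_right, mem_erase, mem_univ, and_true] at hj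
    rw [hj, inr_mem_slackFacet_iff]

open Classical in
theorem IsSlackRanking.card_extensions_eq_two [Fintype T] (hr : IsSlackRanking r) {c : T → ι}
    {τ : Finset (T ⊕ ι)} (hcard : #τ + 1 = Fintype.card ι) (hτ : Dominant r τ)
    (himage : τ.image (Sum.elim c id) = univ.erase i₀) (hne : τ ≠ slackFacet T i₀) :
    #{x | x ∉ τ ∧ Dominant r (insert x τ)} = 2 := by
  obtain ⟨t, ht⟩ : ∃ t, .inl t ∈ τ := by
    by_contra hcon
    exact hne (eq_slackFacet_of_forall_inl_notMem (not_exists.1 hcon) himage)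
  exact hτ.card_extensions_eq_two hr.injective hcard ⟨_, ht⟩ fun a =>
    ⟨.inr a, fun i hi => ⟨_, ht, hr.lt_slack i a t hi.symm⟩⟩

end Slack

section Rankings

variable {T ι α : Type*} [LinearOrder α]

-- Double counting: the only facet with an odd number of extensions is `slackFacet`, so some
-- dominant set has an odd number of deletions.
theorem IsSlackRanking.exists_dominant_image_eq_univ [Finite T] [Nonempty T] [Fintype ι]
    [Nonempty ι] [DecidableEq ι] {r : ι → T ⊕ ι → α} (hr : IsSlackRanking r) (c : T → ι) :
    ∃ σ, Dominant r σ ∧ σ.image (Sum.elim c id) = univ := by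
  classical
  have := Fintype.ofFinite T
  obtain ⟨i₀⟩ := ‹Nonempty ι›
  let facets : Finset (Finset (T ⊕ ι)) := {τ | (#τ + 1 = Fintype.card ι ∧ Dominant r τ) ∧
    τ.image (Sum.elim c id) = univ.erase i₀}
  have hmem : slackFacet T i₀ ∈ facets := by
    obtain ⟨w, hw⟩ := Finite.exists_max fun t => r i₀ (.inl t)
    refine mem_filter.2 ⟨mem_univ _, ⟨card_slackFacet_add_one, ?_⟩, ?_⟩
    · exact (hr.dominant_insert_slackFacet_iff.2 hw).mono (subset_insert _ _)
    · rw [slackFacet, image_image, Sum.elim_comp_inr, image_id]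
  have hodd : Odd (∑ τ ∈ facets, #{x | x ∉ τ ∧ Dominant r (insert x τ)}) := by
    rw [← add_sum_erase _ _ hmem, hr.card_extensions_slackFacet]
    refine odd_one.add_even (even_sum _ fun τ hτ => ?_)
    obtain ⟨hne, hτ⟩ := mem_erase.1 hτ
    obtain ⟨-, ⟨hcard, hτ⟩, himage⟩ := mem_filter.1 hτ
    rw [hr.card_extensions_eq_two hcard hτ himage hne]
    exact even_two
  have hcount := sum_card_filter_erase_eq_sum_card_filter_insert (P := Dominant r)
    (Q := fun τ => τ.image (Sum.elim c id) = univ.erase i₀) (fun _ _ hτσ hσ => hσ.mono hτσ)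
    (Fintype.card ι)
  rw [← hcount, odd_sum_iff_odd_card_odd] at hodd
  obtain ⟨σ, hσ⟩ := card_pos.1 hodd.pos
  obtain ⟨hσ, hσodd⟩ := mem_filter.1 hσ
  obtain ⟨-, hcard, hσ⟩ := mem_filter.1 hσ
  exact ⟨σ, hσ, image_eq_univ_of_odd_card_filter_image_erase hcard hσodd⟩

theorem exists_isSlackRanking [Countable T] [Countable ι] (f : ι → T → α) :
    ∃ r : ι → T ⊕ ι → WithBot (WithTop α) ×ₗ ℕ, IsSlackRanking r ∧
      ∀ i s t, r i (.inl s) ≤ r i (.inl t) → f i s ≤ f i t := by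
  classical
  obtain ⟨e, he⟩ := Countable.exists_injective_nat (T ⊕ ι)
  let rank (i : ι) : T ⊕ ι → WithBot (WithTop α) :=
    Sum.elim (fun t => (f i t : WithTop α)) fun j => if j = i then ⊥ else (⊤ : WithTop α)
  refine ⟨fun i x => toLex (rank i x, e x), ⟨?_, ?_, ?_⟩, ?_⟩
  · intro i x y h
    exact he (congrArg (fun p => (ofLex p).2) h)
  · intro i t
    simp [Prod.Lex.toLex_lt_toLex, rank]
  · intro i j t h
    have hj : rank i (.inr j) = (⊤ : WithTop α) := if_neg h
    exact Prod.Lex.toLex_lt_toLex.2 (.inl (hj ▸ WithBot.coe_lt_coe.2 (WithTop.coe_lt_top (f i t))))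
  · intro i s t h
    simpa [rank] using (Prod.Lex.toLex_le_toLex'.1 h).1

/-- The slack colours of a rainbow dominant set are of no help in beating it. -/
theorem exists_forall_exists_mem_image_le [Finite T] [Nonempty T] [Finite ι] [Nonempty ι]
    [DecidableEq ι] (f : ι → T → α) (c : T → ι) :
    ∃ σ : Finset T, σ.Nonempty ∧ ∀ t, ∃ i ∈ σ.image c, ∀ s ∈ σ, f i t ≤ f i s := by
  classical
  have := Fintype.ofFinite ι
  obtain ⟨r, hr, hrf⟩ := exists_isSlackRanking f
  obtain ⟨σ, hσ, hrainbow⟩ := hr.exists_dominant_image_eq_univ c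
  have hcolour : ∀ t, ∃ i ∈ σ.toLeft.image c, ∀ s ∈ σ.toLeft, f i t ≤ f i s := by
    intro t
    obtain ⟨i, hi⟩ := hσ (.inl t)
    refine ⟨i, ?_, fun s hs => hrf i t s (hi _ (mem_toLeft.1 hs))⟩
    obtain ⟨x | j, hx, hxi⟩ := mem_image.1 (hrainbow ▸ mem_univ i)
    · exact mem_image.2 ⟨x, mem_toLeft.2 hx, hxi⟩
    · obtain rfl : j = i := hxi
      exact absurd (hi _ hx) (hr.slack_lt j t).not_ge
  refine ⟨σ.toLeft, ?_, hcolour⟩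
  obtain ⟨i, hi, -⟩ := hcolour (Classical.arbitrary T)
  exact image_nonempty.1 ⟨i, hi⟩

end Rankings

/-! ### The Knaster–Kuratowski–Mazurkiewicz lemma -/

section KKM

theorem exists_mem_le_of_forall_gt {X β : Type*} [TopologicalSpace X] [LinearOrder β]
    [TopologicalSpace β] [ClosedIicTopology β] [DenselyOrdered β] {K : Set X} {φ : X → β} {b : β}
    (hK : IsCompact K) (hne : K.Nonempty) (hφ : ContinuousOn φ K)
    (h : ∀ b' > b, ∃ x ∈ K, φ x ≤ b') : ∃ x ∈ K, φ x ≤ b := by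
  obtain ⟨x, hx, hmin⟩ := hK.exists_isMinOn hne hφ
  exact ⟨x, hx, le_of_forall_gt_imp_ge_of_dense fun b' hb' =>
    let ⟨y, hy, hyb⟩ := h b' hb'
    (hmin hy).trans hyb⟩

variable {ι : Type*} [Fintype ι]

theorem finite_setOf_sum_eq (N : ℕ) : {x : ι → ℕ | ∑ i, x i = N}.Finite := by
  classical
  exact (piAntidiag univ N).finite_toSet.subset fun x hx => by simpa using hx

variable [Nonempty ι]

theorem exists_le_sum_eq_of_sum_le {l : ι → ℕ} {N : ℕ} (h : ∑ i, l i ≤ N) :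
    ∃ y, l ≤ y ∧ ∑ i, y i = N := by
  classical
  refine ⟨l + Pi.single (Classical.arbitrary ι) (N - ∑ i, l i), le_self_add, ?_⟩
  simp only [Pi.add_apply, sum_add_distrib, sum_pi_single', mem_univ, if_true]
  omega

theorem exists_gridPoints_near_forall_colour [DecidableEq ι] (N : ℕ) (c : (ι → ℕ) → ι) :
    ∃ (σ : Finset (ι → ℕ)) (l : ι → ℕ), σ.Nonempty ∧ (∀ i ∉ σ.image c, l i = 0) ∧
      ∀ x ∈ σ, ∑ i, x i = N ∧ ∀ i, l i ≤ x i ∧ x i ≤ l i + Fintype.card ι := by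
  classical
  let T := {x : ι → ℕ // ∑ i, x i = N}
  have : Finite T := finite_setOf_sum_eq N
  have : Nonempty T :=
    let ⟨y, _, hy⟩ := exists_le_sum_eq_of_sum_le (l := (0 : ι → ℕ)) (N := N) (by simp)
    ⟨⟨y, hy⟩⟩
  obtain ⟨σ, hσ, hdom⟩ :=
    exists_forall_exists_mem_image_le (fun i (x : T) => x.1 i) fun x : T => c x.1
  let l : ι → ℕ := fun i => if i ∈ σ.image (fun x => c x.1) then σ.inf' hσ fun x => x.1 i else 0
  have hl : ∀ x ∈ σ, ∀ i, l i ≤ x.1 i := by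
    intro x hx i
    simp only [l]
    split_ifs
    · exact inf'_le _ hx
    · exact Nat.zero_le _
  have hlt : N < ∑ i, (l i + 1) := by
    by_contra hle
    obtain ⟨y, hly, hy⟩ := exists_le_sum_eq_of_sum_le (not_lt.1 hle)
    obtain ⟨i, hi, hyi⟩ := hdom ⟨y, hy⟩
    have hyl : y i ≤ l i := by
      simp only [l, if_pos hi]
      exact le_inf' _ _ hyi
    exact absurd (hly i) (by simp only; omega)
  have hub : ∀ x ∈ σ, ∀ i, x.1 i ≤ l i + Fintype.card ι := by
    intro x hx i
    have hsum := x.2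
    rw [sum_add_distrib, sum_const, smul_eq_mul, mul_one, card_univ] at hlt
    rw [← add_sum_erase _ _ (mem_univ i)] at hlt hsum
    have := sum_le_sum fun j (_ : j ∈ univ.erase i) => hl x hx j
    omega
  refine ⟨σ.map (.subtype _), l, hσ.map, fun i hi => if_neg fun h => hi ?_, ?_⟩
  · rwa [map_eq_image, image_image]
  · simp only [mem_map, forall_exists_index, and_imp]
    rintro _ x hx rfl
    exact ⟨x.2, fun i => ⟨hl x hx i, hub x hx i⟩⟩

theorem exists_gridPoint_near_colours (N : ℕ) (c : (ι → ℕ) → ι) :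
    ∃ x : ι → ℕ, ∑ i, x i = N ∧ ∀ j, x j ≤ Fintype.card ι ∨ ∃ y : ι → ℕ, ∑ i, y i = N ∧ c y = j ∧
      ∀ i, x i ≤ y i + Fintype.card ι ∧ y i ≤ x i + Fintype.card ι := by
  classical
  obtain ⟨σ, l, ⟨x, hx⟩, hl, hσ⟩ := exists_gridPoints_near_forall_colour N c
  refine ⟨x, (hσ x hx).1, fun j => ?_⟩
  by_cases hj : j ∈ σ.image c
  · obtain ⟨y, hy, hyj⟩ := mem_image.1 hj
    refine .inr ⟨y, (hσ y hy).1, hyj, fun i => ?_⟩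
    have := (hσ x hx).2 i
    have := (hσ y hy).2 i
    omega
  · have := (hσ x hx).2 j
    rw [hl j hj] at this
    exact .inl (by omega)

variable {B : ι → Set (ι → ℝ)}

theorem exists_mem_stdSimplex_near_of_cover (hcover : ∀ x ∈ stdSimplex ℝ ι, ∃ j, x ∈ B j) {ε : ℝ}
    (hε : 0 < ε) :
    ∃ x ∈ stdSimplex ℝ ι, ∀ j, x j ≤ ε ∨ ∃ y ∈ B j, dist x y ≤ ε := by
  classical
  obtain ⟨N, hN⟩ := exists_nat_gt (Fintype.card ι / ε)
  have hN₀ : (0 : ℝ) < N := lt_of_le_of_lt (by positivity) hN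
  have hmesh : Fintype.card ι / (N : ℝ) ≤ ε := ((div_lt_comm₀ hε hN₀).1 hN).le
  let scale (y : ι → ℕ) : ι → ℝ := fun i => y i / N
  have hscale : ∀ y : ι → ℕ, ∑ i, y i = N → scale y ∈ stdSimplex ℝ ι := fun y hy =>
    ⟨fun i => by positivity, by
      rw [← sum_div, ← Nat.cast_sum, hy, div_self hN₀.ne']⟩
  choose! c hc using fun y hy => hcover _ (hscale y hy)
  obtain ⟨x, hx, hxc⟩ := exists_gridPoint_near_colours N c
  refine ⟨scale x, hscale x hx, fun j => (hxc j).imp (fun hj => ?_) ?_⟩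
  · exact le_trans (div_le_div_of_nonneg_right (by exact_mod_cast hj) hN₀.le) hmesh
  · rintro ⟨y, hy, rfl, hxy⟩
    refine ⟨scale y, hc y hy, (dist_pi_le_iff hε.le).2 fun i => le_trans ?_ hmesh⟩
    obtain ⟨h₁, h₂⟩ := hxy i
    rw [Real.dist_eq, ← sub_div, abs_div, abs_of_pos hN₀]
    gcongr
    rw [abs_sub_le_iff, sub_le_iff_le_add', sub_le_iff_le_add']
    exact_mod_cast And.intro h₁ h₂

theorem exists_mem_stdSimplex_forall_mem_of_facet_subset (hB : ∀ j, IsClosed (B j))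
    (hcover : ∀ x ∈ stdSimplex ℝ ι, ∃ j, x ∈ B j)
    (hfacet : ∀ x ∈ stdSimplex ℝ ι, ∀ j, x j = 0 → x ∈ B j) :
    ∃ x ∈ stdSimplex ℝ ι, ∀ j, x ∈ B j := by
  classical
  let φ (x : ι → ℝ) : ENNReal :=
    univ.sup fun j => min (ENNReal.ofReal (x j)) (Metric.infEDist x (B j))
  have hφ : Continuous φ := Continuous.finset_sup_apply fun j _ =>
    (ENNReal.continuous_ofReal.comp (continuous_apply j)).min Metric.continuous_infEDist
  obtain ⟨x, hx, hφx⟩ : ∃ x ∈ stdSimplex ℝ ι, φ x ≤ 0 := by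
    refine exists_mem_le_of_forall_gt (isCompact_stdSimplex ℝ ι)
      ⟨_, single_mem_stdSimplex ℝ (Classical.arbitrary ι)⟩ hφ.continuousOn fun b hb => ?_
    obtain ⟨ε, hε, hεb⟩ := ENNReal.lt_iff_exists_nnreal_btwn.1 hb
    obtain ⟨x, hx, hxε⟩ :=
      exists_mem_stdSimplex_near_of_cover hcover (NNReal.coe_pos.2 (ENNReal.coe_pos.1 hε))
    refine ⟨x, hx, Finset.sup_le fun j _ => le_trans ?_ hεb.le⟩
    obtain hj | ⟨y, hy, hxy⟩ := hxε j
    · exact min_le_of_left_le (ENNReal.ofReal_le_of_le_toReal hj)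
    · refine min_le_of_right_le ((Metric.infEDist_le_edist_of_mem hy).trans ?_)
      rw [edist_dist]
      exact ENNReal.ofReal_le_of_le_toReal hxy
  refine ⟨x, hx, fun j => ?_⟩
  have hj : min (ENNReal.ofReal (x j)) (Metric.infEDist x (B j)) ≤ 0 :=
    (Finset.le_sup (mem_univ j)).trans hφx
  obtain hj | hj := min_le_iff.1 hj
  · exact hfacet x hx j ((ENNReal.ofReal_eq_zero.1 (nonpos_iff_eq_zero.1 hj)).antisymm (hx.1 j))
  · rw [← (hB j).closure_eq, Metric.mem_closure_iff_infEDist_zero]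
    exact nonpos_iff_eq_zero.1 hj

end KKM

/-! ### Envy-free division -/

section EnvyFreeDivision

variable {ι : Type*} [Fintype ι]

theorem exists_perm_forall_pos {w : ι → ι → ℝ} (hrow : ∀ i, w i ∈ stdSimplex ℝ ι)
    (hcol : ∀ j, ∑ i, w i j ≤ 1) : ∃ σ : Equiv.Perm ι, ∀ i, 0 < w i (σ i) := by
  classical
  have hall : ∀ s : Finset ι, #s ≤ #(s.biUnion fun i => {j | 0 < w i j}) := by
    intro s
    let N : Finset ι := s.biUnion fun i => {j | 0 < w i j}
    have hzero : ∀ i ∈ s, ∀ j ∉ N, w i j = 0 := fun i hi j hj =>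
      (not_lt.1 fun hpos => hj (mem_biUnion.2 ⟨i, hi, by simpa using hpos⟩)).antisymm
        ((hrow i).1 j)
    have hcard : (#s : ℝ) ≤ #N :=
      calc (#s : ℝ) = ∑ i ∈ s, ∑ j, w i j := by simp [(hrow _).2]
        _ = ∑ i ∈ s, ∑ j ∈ N, w i j := sum_congr rfl fun i hi =>
            (sum_subset (subset_univ N) fun j _ hj => hzero i hi j hj).symm
        _ = ∑ j ∈ N, ∑ i ∈ s, w i j := sum_comm
        _ ≤ ∑ j ∈ N, ∑ i, w i j := sum_le_sum fun j _ =>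
            sum_le_sum_of_subset_of_nonneg (subset_univ s) fun i _ _ => (hrow i).1 j
        _ ≤ ∑ j ∈ N, 1 := sum_le_sum fun j _ => hcol j
        _ = #N := by simp
    exact_mod_cast hcard
  obtain ⟨f, hf, hpos⟩ := (all_card_le_biUnion_card_iff_exists_injective _).1 hall
  exact ⟨.ofBijective f (Finite.injective_iff_bijective.1 hf), fun i => by simpa using hpos i⟩

variable [Nonempty ι]

theorem exists_continuous_weights {X : Type*} [TopologicalSpace X] {v : ι → X → ℝ}
    (hv : ∀ j, Continuous (v j)) {ε : ℝ} (hε : 0 < ε) :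
    ∃ w : ι → X → ℝ, (∀ j, Continuous (w j)) ∧ (∀ x, (w · x) ∈ stdSimplex ℝ ι) ∧
      ∀ j x, 0 < w j x → ∀ l, v l x < v j x + ε := by
  let V (x : X) : ℝ := univ.sup' univ_nonempty fun j => v j x
  have hV : Continuous V := Continuous.finset_sup'_apply univ_nonempty fun j _ => hv j
  have hle : ∀ l x, v l x ≤ V x := fun l x => le_sup' (fun j => v j x) (mem_univ l)
  let p (j : ι) (x : X) : ℝ := max 0 (v j x - V x + ε)
  have hp : ∀ j, Continuous (p j) := fun j => continuous_const.max (by fun_prop)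
  have hp₀ : ∀ j x, 0 ≤ p j x := fun j x => le_max_left _ _
  have hsum : ∀ x, 0 < ∑ j, p j x := fun x => by
    obtain ⟨j, -, hj⟩ : ∃ j ∈ univ, V x = v j x := exists_mem_eq_sup' univ_nonempty _
    exact sum_pos' (fun j _ => hp₀ j x) ⟨j, mem_univ j, lt_max_of_lt_right (by
      rwa [hj, sub_self, zero_add])⟩
  refine ⟨fun j x => p j x / ∑ l, p l x, fun j => ?_, fun x => ⟨fun j => ?_, ?_⟩, ?_⟩
  · exact (hp j).div (continuous_finsetSum _ fun l _ => hp l) fun x => (hsum x).ne'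
  · exact div_nonneg (hp₀ j x) (hsum x).le
  · rw [← sum_div, div_self (hsum x).ne']
  · intro j x hpos l
    have hpj : 0 < p j x := (div_pos_iff_of_pos_right (hsum x)).1 hpos
    have hj : 0 < v j x - V x + ε := (lt_max_iff.1 hpj).resolve_left (lt_irrefl 0)
    linarith [hle l x]

variable {v : ι → ι → (ι → ℝ) → ℝ}

theorem exists_perm_almost_best (hv : ∀ i j, Continuous (v i j)) {ε : ℝ} (hε : 0 < ε)
    (hungry : ∀ x ∈ stdSimplex ℝ ι, ∀ i j, x j = 0 → ∃ l, v i j x + ε ≤ v i l x) :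
    ∃ x ∈ stdSimplex ℝ ι, ∃ σ : Equiv.Perm ι, ∀ i j, v i j x ≤ v i (σ i) x + ε := by
  choose w hw hw₁ hbest using fun i => exists_continuous_weights (hv i) hε
  obtain ⟨x, hx, hcol⟩ := exists_mem_stdSimplex_forall_mem_of_facet_subset
    (B := fun j => {x | ∑ i, w i j x ≤ 1})
    (fun j => isClosed_le (continuous_finsetSum _ fun i _ => hw i j) continuous_const)
    (fun x _ => by
      have htotal : ∑ j, ∑ i, w i j x ≤ ∑ _j : ι, (1 : ℝ) := by
        rw [sum_comm]
        exact sum_le_sum fun i _ => (hw₁ i x).2.le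
      obtain ⟨j, -, hj⟩ := exists_le_of_sum_le univ_nonempty htotal
      exact ⟨j, hj⟩)
    (fun x hx j hj => by
      have hnonpos : ∀ i, w i j x ≤ 0 := fun i => by
        obtain ⟨l, hl⟩ := hungry x hx i j hj
        exact not_lt.1 fun hpos => (hbest i j x hpos l).not_ge hl
      exact (sum_nonpos fun i _ => hnonpos i).trans (zero_le_one (α := ℝ)))
  obtain ⟨σ, hσ⟩ := exists_perm_forall_pos (fun i => hw₁ i x) hcol
  exact ⟨x, hx, σ, fun i j => (hbest i (σ i) x (hσ i) j).le⟩

theorem exists_perm_best (hv : ∀ i j, Continuous (v i j)) {δ : ℝ} (hδ : 0 < δ)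
    (hungry : ∀ x ∈ stdSimplex ℝ ι, ∀ i j, x j = 0 → ∃ l, v i j x + δ ≤ v i l x) :
    ∃ x ∈ stdSimplex ℝ ι, ∃ σ : Equiv.Perm ι, ∀ i j, v i j x ≤ v i (σ i) x := by
  classical
  let envy (x : ι → ℝ) : ℝ := univ.inf' univ_nonempty fun σ : Equiv.Perm ι =>
    univ.sup' univ_nonempty fun p : ι × ι => v p.1 p.2 x - v p.1 (σ p.1) x
  have henvy : Continuous envy := Continuous.finset_inf'_apply _ fun σ _ =>
    Continuous.finset_sup'_apply _ fun p _ => (hv _ _).sub (hv _ _)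
  have henvy_le : ∀ x b, envy x ≤ b ↔ ∃ σ : Equiv.Perm ι, ∀ i j, v i j x ≤ v i (σ i) x + b := by
    intro x b
    simp only [envy, inf'_le_iff, sup'_le_iff, mem_univ, true_and, forall_const, Prod.forall,
      sub_le_iff_le_add']
  obtain ⟨x, hx, hxenvy⟩ : ∃ x ∈ stdSimplex ℝ ι, envy x ≤ 0 := by
    refine exists_mem_le_of_forall_gt (isCompact_stdSimplex ℝ ι)
      ⟨_, single_mem_stdSimplex ℝ (Classical.arbitrary ι)⟩ henvy.continuousOn fun ε hε => ?_
    obtain ⟨x, hx, hσ⟩ := exists_perm_almost_best hv (lt_min hε hδ) fun x hx i j hj =>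
      (hungry x hx i j hj).imp fun l hl => (by gcongr; exact min_le_right _ _ : _ ≤ _).trans hl
    exact ⟨x, hx, ((henvy_le x _).2 hσ).trans (min_le_left _ _)⟩
  obtain ⟨σ, hσ⟩ := (henvy_le x 0).1 hxenvy
  exact ⟨x, hx, σ, fun i j => by simpa using hσ i j⟩

end EnvyFreeDivision

section Cuts

variable {n : ℕ}

theorem continuous_partialSum (m : Fin (n + 1)) :
    Continuous fun x : Fin n → ℝ => Fin.partialSum x m := by
  induction m using Fin.induction with
  | zero => simpa only [Fin.partialSum_zero] using continuous_const
  | succ j ih =>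
    simp only [Fin.partialSum_succ]
    exact ih.add (continuous_apply j)

theorem sum_succ_sub_castSucc (G : Fin (n + 1) → ℝ) :
    ∑ j : Fin n, (G j.succ - G j.castSucc) = G (Fin.last n) - G 0 := by
  have h := (Fin.sum_univ_succ G).symm.trans (Fin.sum_univ_castSucc G)
  rw [sum_sub_distrib]
  linarith

theorem partialSum_last (x : Fin n → ℝ) : Fin.partialSum x (Fin.last n) = ∑ j, x j := by
  simpa [Fin.partialSum_succ] using (sum_succ_sub_castSucc (Fin.partialSum x)).symm

theorem exists_envyFree_cuts [NeZero n] {F : Fin n → ℝ → ℝ} (hF : ∀ i, Continuous (F i))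
    (hF₀ : ∀ i, F i 0 = 0) (hF₁ : ∀ i, F i 1 = 1) :
    ∃ s : Fin (n + 1) → ℝ, Monotone s ∧ s 0 = 0 ∧ s (Fin.last n) = 1 ∧
      ∃ σ : Equiv.Perm (Fin n), ∀ i j : Fin n, F i (s j.succ) - F i (s j.castSucc) ≤
        F i (s (σ i).succ) - F i (s (σ i).castSucc) := by
  have hn : (0 : ℝ) < 1 / n := by have := NeZero.pos n; positivity
  let v (i j : Fin n) (x : Fin n → ℝ) : ℝ :=
    F i (Fin.partialSum x j.succ) - F i (Fin.partialSum x j.castSucc)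
  have hv : ∀ i j, Continuous (v i j) := fun i j =>
    ((hF i).comp (continuous_partialSum _)).sub ((hF i).comp (continuous_partialSum _))
  have hungry : ∀ x ∈ stdSimplex ℝ (Fin n), ∀ i j, x j = 0 → ∃ l, v i j x + 1 / n ≤ v i l x := by
    intro x hx i j hj
    have hsum : ∑ l, v i l x = 1 := by
      rw [sum_succ_sub_castSucc fun m => F i (Fin.partialSum x m), partialSum_last, hx.2,
        Fin.partialSum_zero, hF₀, hF₁, sub_zero]
    obtain ⟨l, -, hl⟩ := exists_le_of_sum_le (s := univ) (f := fun _ : Fin n => (1 : ℝ) / n)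
      (g := (v i · x)) univ_nonempty (by simp [hsum])
    have hvj : v i j x = 0 := by simp only [v, Fin.partialSum_succ, hj, add_zero, sub_self]
    exact ⟨l, by rwa [hvj, zero_add]⟩
  obtain ⟨x, hx, σ, hσ⟩ := exists_perm_best hv hn hungry
  refine ⟨Fin.partialSum x, Fin.monotone_iff_le_succ.2 fun j => ?_, Fin.partialSum_zero x, ?_, σ,
    hσ⟩
  · rw [Fin.partialSum_succ]
    exact le_add_of_nonneg_right (hx.1 j)
  · rw [partialSum_last, hx.2]

end Cuts

/-! ### Values of intervals -/

section Values

variable {n : ℕ} (I : Instance n) (i : Fin n)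

theorem Instance.integrableOn_density : IntegrableOn (I.density i) (Set.Icc 0 1) :=
  (I.continuousOn i).integrableOn_Icc

theorem Instance.integrable_indicator_density :
    Integrable ((Set.Icc (0 : ℝ) 1).indicator (I.density i)) :=
  (integrable_indicator_iff measurableSet_Icc).2 (I.integrableOn_density i)

/-- The cumulative value `V_i([0, t])`, for `t` in the cake. The density may be arbitrary outside
the cake, so it is cut off there, which makes the cumulative value continuous on all of `ℝ`. -/
def Instance.cdf (t : ℝ) : ℝ :=
  ∫ x in (0 : ℝ)..t, (Set.Icc (0 : ℝ) 1).indicator (I.density i) x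

theorem Instance.continuous_cdf : Continuous (I.cdf i) :=
  (I.integrable_indicator_density i).continuous_primitive 0

theorem Instance.cdf_zero : I.cdf i 0 = 0 :=
  intervalIntegral.integral_same

theorem Instance.value_eq_cdf_sub_cdf {S : Set ℝ} {a b : ℝ} (ha : 0 ≤ a) (hab : a ≤ b)
    (hb : b ≤ 1) (hIoo : Set.Ioo a b ⊆ S) (hIcc : S ⊆ Set.Icc a b) :
    I.value i S = I.cdf i b - I.cdf i a := by
  have hS : S =ᵐ[volume] Set.Ioc a b :=
    Filter.EventuallyLE.antisymm (hIcc.eventuallyLE.trans Ioc_ae_eq_Icc.symm.le)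
      (Ioo_ae_eq_Ioc.symm.le.trans hIoo.eventuallyLE)
  have hint (c d : ℝ) := (I.integrable_indicator_density i).intervalIntegrable (a := c) (b := d)
  rw [Instance.value, setIntegral_congr_set hS, Instance.cdf, Instance.cdf,
    intervalIntegral.integral_interval_sub_left (hint 0 b) (hint 0 a),
    intervalIntegral.integral_of_le hab]
  exact setIntegral_congr_fun measurableSet_Ioc fun x hx =>
    (Set.indicator_of_mem (Set.mem_Icc.2 ⟨ha.trans hx.1.le, hx.2.trans hb⟩) _).symm

theorem Instance.cdf_one : I.cdf i 1 = 1 :=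
  calc I.cdf i 1 = I.cdf i 1 - I.cdf i 0 := by rw [I.cdf_zero, sub_zero]
    _ = I.value i (Set.Icc 0 1) := (I.value_eq_cdf_sub_cdf i le_rfl zero_le_one le_rfl
        Set.Ioo_subset_Icc_self subset_rfl).symm
    _ = 1 := I.normalized i

theorem Instance.value_mono {S T : Set ℝ} (hST : S ⊆ T) (hT : T ⊆ Set.Icc 0 1)
    (hTm : MeasurableSet T) : I.value i S ≤ I.value i T :=
  setIntegral_mono_set ((I.integrableOn_density i).mono_set hT)
    ((ae_restrict_mem hTm).mono fun x hx => I.nonneg i x (hT hx)) hST.eventuallyLE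

variable {I i} {k : ℕ} {S : Set ℝ}

theorem IsPortion.measurableSet (h : IsPortion k S) : MeasurableSet S := by
  obtain ⟨J, hJ, -, rfl⟩ := h
  exact MeasurableSet.iUnion fun m => (hJ m).1.measurableSet

theorem IsPortion.subset_Icc (h : IsPortion k S) : S ⊆ Set.Icc 0 1 := by
  obtain ⟨J, hJ, -, rfl⟩ := h
  exact Set.iUnion_subset fun m => (hJ m).2

theorem IsPortion.value_le_one (h : IsPortion k S) : I.value i S ≤ 1 :=
  (I.value_mono i h.subset_Icc subset_rfl measurableSet_Icc).trans_eq (I.normalized i)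

end Values

/-! ### Layouts -/

section Layouts

variable {κ : Type*} [Fintype κ] {freeDisposal : Bool} {a b : κ → ℝ}

/-- The numbers `a q ≤ b q` are the endpoints of non-overlapping subintervals of the cake, which
cover it up to finitely many points if the whole cake has to be allocated. Unlike the intervals
themselves, the possible endpoints form a compact set. -/
structure IsLayout (freeDisposal : Bool) (a b : κ → ℝ) : Prop where
  nonneg : ∀ q, 0 ≤ a q
  le : ∀ q, a q ≤ b q
  le_one : ∀ q, b q ≤ 1
  ordered : Pairwise fun q q' => b q ≤ a q' ∨ b q' ≤ a q
  whole : freeDisposal = false → ∑ q, (b q - a q) = 1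

theorem isCompact_isLayout :
    IsCompact {p : (κ → ℝ) × (κ → ℝ) | IsLayout freeDisposal p.1 p.2} := by
  have hfst : ∀ q, Continuous fun p : (κ → ℝ) × (κ → ℝ) => p.1 q :=
    fun q => (continuous_apply q).comp continuous_fst
  have hsnd : ∀ q, Continuous fun p : (κ → ℝ) × (κ → ℝ) => p.2 q :=
    fun q => (continuous_apply q).comp continuous_snd
  refine (isCompact_Icc (a := (0 : (κ → ℝ) × (κ → ℝ))) (b := 1)).of_isClosed_subset ?_
    fun p hp => ⟨⟨hp.nonneg, fun q => (hp.nonneg q).trans (hp.le q)⟩,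
      ⟨fun q => (hp.le q).trans (hp.le_one q), hp.le_one⟩⟩
  have hiff : ∀ p : (κ → ℝ) × (κ → ℝ), IsLayout freeDisposal p.1 p.2 ↔ (∀ q, 0 ≤ p.1 q) ∧
      (∀ q, p.1 q ≤ p.2 q) ∧ (∀ q, p.2 q ≤ 1) ∧
      (∀ q q', q ≠ q' → p.2 q ≤ p.1 q' ∨ p.2 q' ≤ p.1 q) ∧
      (freeDisposal = false → ∑ q, (p.2 q - p.1 q) = 1) := fun p =>
    ⟨fun h => ⟨h.nonneg, h.le, h.le_one, h.ordered, h.whole⟩,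
      fun ⟨nonneg, le, le_one, ordered, whole⟩ => ⟨nonneg, le, le_one, ordered, whole⟩⟩
  simp only [hiff, Set.ofPred_and, Set.ofPred_forall, Set.ofPred_or]
  refine (isClosed_iInter fun q => isClosed_le continuous_const (hfst q)).inter <|
    (isClosed_iInter fun q => isClosed_le (hfst q) (hsnd q)).inter <|
    (isClosed_iInter fun q => isClosed_le (hsnd q) continuous_const).inter <|
    (isClosed_iInter fun q => isClosed_iInter fun q' => isClosed_iInter fun _ =>
      (isClosed_le (hsnd q) (hfst q')).union (isClosed_le (hsnd q') (hfst q))).inter <|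
    isClosed_iInter fun _ => isClosed_eq
      (continuous_finsetSum _ fun q _ => (hsnd q).sub (hfst q)) continuous_const

theorem isLayout_of_monotone {N : ℕ} {s : Fin (N + 1) → ℝ} (hs : Monotone s) (hs₀ : s 0 = 0)
    (hs₁ : s (Fin.last N) = 1) :
    IsLayout freeDisposal (fun t : Fin N => s t.castSucc) fun t => s t.succ where
  nonneg t := hs₀.symm.trans_le (hs (Fin.zero_le _))
  le t := hs t.castSucc_lt_succ.le
  le_one t := (hs (Fin.le_last _)).trans_eq hs₁
  ordered t t' ht := ht.lt_or_gt.imp (fun h => hs h) fun h => hs h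
  whole _ := by rw [sum_succ_sub_castSucc, hs₀, hs₁, sub_zero]

/-- The sets `J q` are pairwise disjoint intervals with endpoints `a q` and `b q`, each of which
may or may not contain its endpoints. -/
structure IsIntervalFamily (J : κ → Set ℝ) (a b : κ → ℝ) : Prop where
  ordConnected : ∀ q, (J q).OrdConnected
  Ioo_subset : ∀ q, Set.Ioo (a q) (b q) ⊆ J q
  subset_Icc : ∀ q, J q ⊆ Set.Icc (a q) (b q)
  disjoint : Pairwise (Function.onFun Disjoint J)

variable {J : κ → Set ℝ}

theorem IsIntervalFamily.volume_iUnion (hJ : IsIntervalFamily J a b) (hab : ∀ q, a q ≤ b q) :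
    volume (⋃ q, J q) = ENNReal.ofReal (∑ q, (b q - a q)) := by
  have hvol : ∀ q, volume (J q) = ENNReal.ofReal (b q - a q) := fun q =>
    ((measure_mono (hJ.subset_Icc q)).trans_eq Real.volume_Icc).antisymm
      (Real.volume_Ioo.symm.trans_le (measure_mono (hJ.Ioo_subset q)))
  rw [measure_iUnion hJ.disjoint fun q => (hJ.ordConnected q).measurableSet, tsum_fintype,
    ENNReal.ofReal_sum_of_nonneg fun q _ => sub_nonneg.2 (hab q)]
  exact sum_congr rfl fun q _ => hvol q

theorem IsLayout.subset_Icc (h : IsLayout freeDisposal a b) (hJ : IsIntervalFamily J a b) (q : κ) :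
    J q ⊆ Set.Icc 0 1 :=
  (hJ.subset_Icc q).trans (Set.Icc_subset_Icc (h.nonneg q) (h.le_one q))

theorem IsLayout.isPortion_biUnion (h : IsLayout freeDisposal a b) (hJ : IsIntervalFamily J a b)
    {s : Finset κ} {k : ℕ} (hs : #s ≤ k) : IsPortion k (⋃ q ∈ s, J q) := by
  obtain ⟨e⟩ : Nonempty (s ↪ Fin k) := Function.Embedding.nonempty_of_card_le (by simpa using hs)
  refine ⟨Function.extend e (fun q : s => J q) ⊥, fun m => ?_, fun m m' hm => ?_, ?_⟩
  · by_cases hm : ∃ q, e q = m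
    · obtain ⟨q, rfl⟩ := hm
      rw [e.injective.extend_apply]
      exact ⟨hJ.ordConnected q, h.subset_Icc hJ q⟩
    · rw [Function.extend_apply' _ _ _ hm]
      exact ⟨Set.ordConnected_empty, Set.empty_subset _⟩
  · exact (hJ.disjoint.comp_of_injective Subtype.val_injective).disjoint_extend_bot
      (e.injective.factorsThrough _) hm
  · exact (iSup_subtype' ..).trans (iSup_extend_bot e.injective _).symm

theorem IsLayout.value_biUnion (h : IsLayout freeDisposal a b) (hJ : IsIntervalFamily J a b)
    {n : ℕ} (I : Instance n) (i : Fin n) (s : Finset κ) :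
    I.value i (⋃ q ∈ s, J q) = ∑ q ∈ s, (I.cdf i (b q) - I.cdf i (a q)) :=
  (integral_biUnion_finset s (fun q _ => (hJ.ordConnected q).measurableSet)
    (hJ.disjoint.set_pairwise _)
    fun q _ => (I.integrableOn_density i).mono_set (h.subset_Icc hJ q)).trans <|
  sum_congr rfl fun q _ => I.value_eq_cdf_sub_cdf i (h.nonneg q) (h.le q) (h.le_one q)
    (hJ.Ioo_subset q) (hJ.subset_Icc q)

/-- A shared endpoint goes to the interval that comes first in the order of the indices. -/
theorem IsLayout.isIntervalFamily_disjointed [LinearOrder κ] [LocallyFiniteOrderBot κ]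
    (h : IsLayout freeDisposal a b) :
    IsIntervalFamily (disjointed fun q => Set.Icc (a q) (b q)) a b := by
  have hmem : ∀ q x, x ∈ disjointed (fun q => Set.Icc (a q) (b q)) q ↔
      x ∈ Set.Icc (a q) (b q) ∧ ∀ q' < q, x ∉ Set.Icc (a q') (b q') := fun q x => by
    simp only [disjointed, Finset.sup_eq_iSup, Set.sdiff_eq, Set.iSup_eq_iUnion, Finset.mem_Iio,
      Set.mem_inter_iff, Set.mem_compl_iff, Set.mem_iUnion, not_exists]
  refine ⟨fun q => ⟨fun x hx z hz y hy => ?_⟩, fun q x hx => ?_, fun q => disjointed_le _ q,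
    disjoint_disjointed _⟩
  · obtain ⟨hxq, hx⟩ := (hmem q x).1 hx
    obtain ⟨hzq, hz⟩ := (hmem q z).1 hz
    refine (hmem q y).2 ⟨⟨hxq.1.trans hy.1, hy.2.trans hzq.2⟩, fun q' hq' hyq' => ?_⟩
    rcases h.ordered hq'.ne with hle | hle
    · have hyx : y ≤ x := hyq'.2.trans (hle.trans hxq.1)
      exact hx q' hq' (hy.1.antisymm hyx ▸ hyq')
    · have hzy : z ≤ y := (hzq.2.trans hle).trans hyq'.1
      exact hz q' hq' (hzy.antisymm hy.2 ▸ hyq')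
  · refine (hmem q x).2 ⟨Set.Ioo_subset_Icc_self hx, fun q' hq' hxq' => ?_⟩
    rcases h.ordered hq'.ne with hle | hle
    · exact (hxq'.2.trans hle).not_gt hx.1
    · exact (hle.trans hxq'.1).not_gt hx.2

theorem IsLayout.iUnion_Icc (h : IsLayout false a b) (hJ : IsIntervalFamily J a b)
    (hU : ⋃ q, J q = ⋃ q, Set.Icc (a q) (b q)) : ⋃ q, J q = Set.Icc 0 1 := by
  refine (Set.iUnion_subset fun q => h.subset_Icc hJ q).antisymm ?_
  have hclosed : IsClosed (⋃ q, J q) := hU ▸ isClosed_iUnion_of_finite fun q => isClosed_Icc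
  have hnull : volume (Set.Icc 0 1 \ ⋃ q, J q) = 0 := by
    rw [measure_sdiff (Set.iUnion_subset fun q => h.subset_Icc hJ q)
      hclosed.measurableSet.nullMeasurableSet (by simp [hJ.volume_iUnion h.le]),
      hJ.volume_iUnion h.le, h.whole rfl, Real.volume_Icc, sub_zero, tsub_self]
  have hempty : Set.Ioo 0 1 \ ⋃ q, J q = ∅ :=
    (isOpen_Ioo.sdiff hclosed).eq_empty_of_measure_zero
      (measure_mono_null (Set.sdiff_subset_sdiff_left Set.Ioo_subset_Icc_self) hnull)
  calc Set.Icc (0 : ℝ) 1 = closure (Set.Ioo 0 1) := (closure_Ioo zero_ne_one).symm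
    _ ⊆ ⋃ q, J q := closure_minimal (Set.sdiff_eq_empty.1 hempty) hclosed

theorem IsLayout.exists_isIntervalFamily (h : IsLayout freeDisposal a b) :
    ∃ J, IsIntervalFamily J a b ∧ (freeDisposal = false → ⋃ q, J q = Set.Icc 0 1) := by
  let : LinearOrder κ := .lift' _ (Fintype.equivFin κ).injective
  let : LocallyFiniteOrderBot κ :=
    .ofIic κ (fun q => {q' | q' ≤ q}) (by simp)
  refine ⟨_, h.isIntervalFamily_disjointed, ?_⟩
  rintro rfl
  exact h.iUnion_Icc h.isIntervalFamily_disjointed iUnion_disjointed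

end Layouts

section Endpoints

variable {J J' : Set ℝ}

theorem Ioo_sInf_sSup_subset (hJ : J.OrdConnected) (hJ₀ : J ⊆ Set.Icc 0 1) :
    Set.Ioo (sInf J) (sSup J) ⊆ J := by
  rcases J.eq_empty_or_nonempty with rfl | hne
  · simp
  · exact IsConnected.Ioo_csInf_csSup_subset ⟨hne, hJ.isPreconnected⟩
      (bddBelow_Icc.mono hJ₀) (bddAbove_Icc.mono hJ₀)

theorem sSup_le_sInf_or_of_disjoint (hJ : J.OrdConnected) (hJ' : J'.OrdConnected)
    (hJ₀ : J ⊆ Set.Icc 0 1) (hJ'₀ : J' ⊆ Set.Icc 0 1) (hd : Disjoint J J') :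
    sSup J ≤ sInf J' ∨ sSup J' ≤ sInf J := by
  rcases J.eq_empty_or_nonempty with rfl | hne
  · left
    simpa using Real.sInf_nonneg fun x hx => (hJ'₀ hx).1
  rcases J'.eq_empty_or_nonempty with rfl | hne'
  · right
    simpa using Real.sInf_nonneg fun x hx => (hJ₀ hx).1
  by_contra! ⟨hlt, hlt'⟩
  obtain ⟨x, hx, hxlt⟩ := exists_lt_of_lt_csSup hne hlt
  obtain ⟨y', hy', hyx⟩ := exists_lt_of_csInf_lt hne' hxlt
  obtain ⟨x', hx', hxlt'⟩ := exists_lt_of_lt_csSup hne' hlt'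
  obtain ⟨y, hy, hyx'⟩ := exists_lt_of_csInf_lt hne hxlt'
  rcases le_total x x' with hle | hle
  · exact Set.disjoint_left.1 hd hx (hJ'.out hy' hx' ⟨hyx.le, hle⟩)
  · exact Set.disjoint_left.1 hd (hJ.out hy hx ⟨hyx'.le, hle⟩) hx'

end Endpoints

section Allocations

variable {n k : ℕ} {freeDisposal : Bool}

section Owner

variable {κ : Type*} [Fintype κ] {a b : κ → ℝ}

/-- The value to player `i` of the pieces of player `j`, when piece `q` has endpoints `a q` and
`b q` and belongs to player `g q`. -/
def Instance.worth (I : Instance n) (g : κ → Fin n) (a b : κ → ℝ) (i j : Fin n) : ℝ :=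
  ∑ q with g q = j, (I.cdf i (b q) - I.cdf i (a q))

theorem Instance.continuous_worth (I : Instance n) (g : κ → Fin n) (i j : Fin n) :
    Continuous fun p : (κ → ℝ) × (κ → ℝ) => I.worth g p.1 p.2 i j :=
  continuous_finsetSum _ fun q _ =>
    ((I.continuous_cdf i).comp ((continuous_apply q).comp continuous_snd)).sub
      ((I.continuous_cdf i).comp ((continuous_apply q).comp continuous_fst))

theorem IsLayout.exists_isAllocation (h : IsLayout freeDisposal a b) {g : κ → Fin n}
    (hg : ∀ j, #{q | g q = j} ≤ k) : ∃ A : Fin n → Set ℝ, IsAllocation freeDisposal k A ∧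
      (∀ q, Set.Ioo (a q) (b q) ⊆ A (g q)) ∧
      ∀ (I : Instance n) (i j : Fin n), I.value i (A j) = I.worth g a b i j := by
  obtain ⟨J, hJ, hU⟩ := h.exists_isIntervalFamily
  refine ⟨fun j => ⋃ q ∈ ({q | g q = j} : Finset κ), J q,
    ⟨fun j => h.isPortion_biUnion hJ (hg j), fun j j' hj => ?_, fun hfd => ?_⟩,
    fun q => ?_, fun I i j => h.value_biUnion hJ I i _⟩
  · simp only [mem_filter_univ, Set.disjoint_iUnion_left, Set.disjoint_iUnion_right]
    rintro q rfl q' rfl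
    exact hJ.disjoint fun hq => hj (congrArg g hq)
  · rw [← hU hfd]
    ext x
    simp
  · exact (hJ.Ioo_subset q).trans (Set.subset_biUnion_of_mem ((mem_filter_univ q).2 rfl))

end Owner

theorem IsAllocation.exists_isLayout {A : Fin n → Set ℝ} (hA : IsAllocation freeDisposal k A) :
    ∃ a b : Fin n × Fin k → ℝ, IsLayout freeDisposal a b ∧
      ∀ (I : Instance n) (i j : Fin n), I.value i (A j) = I.worth Prod.fst a b i j := by
  choose J hJ hd hU using hA.portion
  have hord : ∀ q : Fin n × Fin k, (J q.1 q.2).OrdConnected := fun q => (hJ q.1 q.2).1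
  have hsub : ∀ q : Fin n × Fin k, J q.1 q.2 ⊆ Set.Icc 0 1 := fun q => (hJ q.1 q.2).2
  have hdisj : Pairwise (Function.onFun Disjoint fun q : Fin n × Fin k => J q.1 q.2) := by
    rintro ⟨i, m⟩ ⟨i', m'⟩ hq
    rcases eq_or_ne i i' with rfl | hi
    · exact hd i m m' fun hm => hq (by rw [hm])
    · have hdA := hA.disjoint i i' hi
      rw [hU i, hU i'] at hdA
      exact hdA.mono (Set.subset_iUnion (J i) m) (Set.subset_iUnion (J i') m')
  have hfam : IsIntervalFamily (fun q : Fin n × Fin k => J q.1 q.2)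
      (fun q => sInf (J q.1 q.2)) fun q => sSup (J q.1 q.2) :=
    ⟨hord, fun q => Ioo_sInf_sSup_subset (hord q) (hsub q), fun q => subset_Icc_csInf_csSup
      (bddBelow_Icc.mono (hsub q)) (bddAbove_Icc.mono (hsub q)), hdisj⟩
  have hle : ∀ q : Fin n × Fin k, sInf (J q.1 q.2) ≤ sSup (J q.1 q.2) := fun q =>
    Real.sInf_le_sSup _ (bddBelow_Icc.mono (hsub q)) (bddAbove_Icc.mono (hsub q))
  have hlayout : IsLayout freeDisposal (fun q : Fin n × Fin k => sInf (J q.1 q.2))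
      fun q => sSup (J q.1 q.2) := by
    refine ⟨fun q => Real.sInf_nonneg fun x hx => (hsub q hx).1, hle,
      fun q => Real.sSup_le (fun x hx => (hsub q hx).2) zero_le_one, fun q q' hq =>
      sSup_le_sInf_or_of_disjoint (hord q) (hord q') (hsub q) (hsub q') (hdisj hq), fun hfd => ?_⟩
    have hcover : ⋃ q : Fin n × Fin k, J q.1 q.2 = Set.Icc 0 1 := by
      rw [← hA.whole hfd, Set.iUnion_prod']
      exact Set.iUnion_congr fun i => (hU i).symm
    have hvol := hfam.volume_iUnion hle
    rw [hcover, Real.volume_Icc, sub_zero] at hvol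
    exact ((ENNReal.ofReal_eq_ofReal_iff zero_le_one
      (sum_nonneg fun q _ => sub_nonneg.2 (hle q))).1 hvol).symm
  refine ⟨_, _, hlayout, fun I i j => ?_⟩
  have hAj : A j = ⋃ q ∈ ({q | q.1 = j} : Finset (Fin n × Fin k)), J q.1 q.2 := by
    rw [hU j]
    ext x
    simp
  rw [hAj]
  exact hlayout.value_biUnion hfam I i _

variable (I : Instance n)

theorem Instance.image_egalitarianWelfare :
    I.egalitarianWelfare '' I.allocationsF freeDisposal k =
      (fun p : (Fin n × Fin k → ℝ) × (Fin n × Fin k → ℝ) =>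
          ⨅ i, I.worth Prod.fst p.1 p.2 i i) ''
        ({p | IsLayout freeDisposal p.1 p.2} ∩
          {p | ∀ i j, I.worth Prod.fst p.1 p.2 i j ≤ I.worth Prod.fst p.1 p.2 i i}) := by
  ext w
  constructor
  · rintro ⟨A, ⟨hA, hEF⟩, rfl⟩
    obtain ⟨a, b, hab, hval⟩ := hA.exists_isLayout
    refine ⟨(a, b), ⟨hab, fun i j => ?_⟩, ?_⟩
    · simpa only [hval] using hEF i j
    · simp only [Instance.egalitarianWelfare, hval]
  · rintro ⟨p, ⟨hp, hEF⟩, rfl⟩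
    have hcard : ∀ j : Fin n, #{q : Fin n × Fin k | q.1 = j} ≤ k := fun j =>
      (card_le_card_of_injOn (t := univ) Prod.snd (fun _ _ => mem_univ _) fun q hq q' hq' hsnd =>
        Prod.ext (((mem_filter_univ _).1 hq).trans ((mem_filter_univ _).1 hq').symm) hsnd).trans_eq
        (card_fin k)
    obtain ⟨A, hA, -, hval⟩ := hp.exists_isAllocation hcard
    refine ⟨A, ⟨hA, fun i j => ?_⟩, ?_⟩
    · simpa only [hval] using hEF i j
    · simp only [Instance.egalitarianWelfare, hval]

/-! ### The optimal egalitarian welfare -/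

theorem Instance.allocationsF_false_subset :
    I.allocationsF false k ⊆ I.allocationsF freeDisposal k := fun _ hA =>
  ⟨⟨hA.1.portion, hA.1.disjoint, fun _ => hA.1.whole rfl⟩, hA.2⟩

theorem Instance.allocationsF_false_nonempty [NeZero n] (hk : 1 ≤ k) :
    (I.allocationsF false k).Nonempty := by
  obtain ⟨s, hs, hs₀, hs₁, σ, hσ⟩ := exists_envyFree_cuts I.continuous_cdf I.cdf_zero I.cdf_one
  have hfibre : ∀ j, ({q | σ.symm q = j} : Finset (Fin n)) = {σ j} := fun j => by
    ext q
    simp [Equiv.symm_apply_eq]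
  obtain ⟨A, hA, -, hval⟩ := (isLayout_of_monotone hs hs₀ hs₁).exists_isAllocation
    (g := σ.symm) (k := k) fun j => by rwa [hfibre, card_singleton]
  refine ⟨A, hA, fun i j => ?_⟩
  simpa only [hval, Instance.worth, hfibre, sum_singleton] using hσ i (σ j)

variable {I}

theorem Instance.one_div_le_value [NeZero n] {A : Fin n → Set ℝ} (hA : A ∈ I.allocationsF false k)
    (i : Fin n) : 1 / n ≤ I.value i (A i) := by
  obtain ⟨hA, hEF⟩ := hA
  have hn : (0 : ℝ) < n := by exact_mod_cast NeZero.pos n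
  have hone : I.value i (⋃ j, A j) = 1 := (congrArg _ (hA.whole rfl)).trans (I.normalized i)
  have hsum : I.value i (⋃ j, A j) = ∑ j, I.value i (A j) :=
    integral_iUnion_fintype (fun j => (hA.portion j).measurableSet) hA.disjoint
      fun j => (I.integrableOn_density i).mono_set (hA.portion j).subset_Icc
  rw [div_le_iff₀' hn]
  calc 1 = ∑ j, I.value i (A j) := by rw [← hsum, hone]
    _ ≤ ∑ _j : Fin n, I.value i (A i) := sum_le_sum fun j _ => hEF i j
    _ = n * I.value i (A i) := by simp

theorem Instance.egalitarianWelfare_le (A : Fin n → Set ℝ) (i : Fin n) :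
    I.egalitarianWelfare A ≤ I.value i (A i) :=
  ciInf_le (Set.finite_range _).bddBelow i

variable [NeZero n] (I) (freeDisposal)

theorem Instance.isGreatest_optEgalitarianF (hk : 1 ≤ k) :
    IsGreatest (I.egalitarianWelfare '' I.allocationsF freeDisposal k)
      (I.optEgalitarianF freeDisposal k) := by
  have hcompact : IsCompact (I.egalitarianWelfare '' I.allocationsF freeDisposal k) := by
    rw [I.image_egalitarianWelfare]
    refine (isCompact_isLayout.inter_right ?_).image ?_
    · simp only [Set.ofPred_forall]
      exact isClosed_iInter fun i => isClosed_iInter fun j =>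
        isClosed_le (I.continuous_worth _ i j) (I.continuous_worth _ i i)
    · simp only [← inf'_univ_eq_ciInf]
      exact Continuous.finset_inf'_apply _ fun i _ => I.continuous_worth _ i i
  exact hcompact.isGreatest_sSup
    (((I.allocationsF_false_nonempty hk).mono I.allocationsF_false_subset).image _)

theorem Instance.one_div_le_optEgalitarianF (hk : 1 ≤ k) :
    1 / n ≤ I.optEgalitarianF freeDisposal k := by
  obtain ⟨A, hA⟩ := I.allocationsF_false_nonempty hk
  exact (le_ciInf (one_div_le_value hA)).trans
    ((I.isGreatest_optEgalitarianF freeDisposal hk).2 ⟨A, I.allocationsF_false_subset hA, rfl⟩)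

theorem Instance.optEgalitarianF_pos (hk : 1 ≤ k) : 0 < I.optEgalitarianF freeDisposal k :=
  (one_div_pos.2 (by exact_mod_cast NeZero.pos n)).trans_le
    (I.one_div_le_optEgalitarianF freeDisposal hk)

theorem Instance.optEgalitarianF_le_one (hk : 1 ≤ k) : I.optEgalitarianF freeDisposal k ≤ 1 := by
  obtain ⟨A, ⟨hA, -⟩, hAopt⟩ := (I.isGreatest_optEgalitarianF freeDisposal hk).1
  exact hAopt.symm.trans_le ((egalitarianWelfare_le A 0).trans (hA.portion 0).value_le_one)

theorem Instance.gainEF_le (hk : 1 ≤ k) : I.gainEF freeDisposal k ≤ n := by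
  have hn : (0 : ℝ) < n := by exact_mod_cast NeZero.pos n
  rw [Instance.gainEF, div_le_iff₀ (I.optEgalitarianF_pos freeDisposal le_rfl)]
  calc I.optEgalitarianF freeDisposal k ≤ 1 := I.optEgalitarianF_le_one freeDisposal hk
    _ = n * (1 / n) := (mul_one_div_cancel hn.ne').symm
    _ ≤ n * I.optEgalitarianF freeDisposal 1 := by
      gcongr
      exact I.one_div_le_optEgalitarianF freeDisposal le_rfl

end Allocations

/-! ### An instance with a large gain -/

section Cells

variable {N : ℕ}

/-- The interior of the `t`-th of `N` equal cells of the cake. -/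
def cell (t : Fin N) : Set ℝ :=
  Set.Ioo (t / N) ((t + 1) / N)

/-- A smooth bump function supported in a cell, which serves to concentrate the value of a player
on that cell. -/
def cellBump (t : Fin N) : ContDiffBump ((t + 1 / 2) / N : ℝ) where
  rIn := 1 / (4 * N)
  rOut := 1 / (2 * N)
  rIn_pos := by have := t.pos; positivity
  rIn_lt_rOut := by have := t.pos; gcongr; norm_num

/-- The share of the value of a cell that lies in `S`, if the cell is valued according to its
normalized bump function. -/
def cellMass (t : Fin N) (S : Set ℝ) : ℝ :=
  ∫ x in S, (cellBump t).normed volume x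

variable {t : Fin N} {S : Set ℝ}

theorem support_cellBump_normed (t : Fin N) :
    Function.support ((cellBump t).normed volume) = cell t := by
  have hN : (N : ℝ) ≠ 0 := by exact_mod_cast t.pos.ne'
  rw [ContDiffBump.support_normed_eq, Real.ball_eq_Ioo, cell, cellBump]
  congr 1 <;> field_simp <;> ring

theorem cellMass_le_one (t : Fin N) (S : Set ℝ) : cellMass t S ≤ 1 :=
  (setIntegral_le_integral (cellBump t).integrable_normed
    (.of_forall (cellBump t).nonneg_normed)).trans_eq (cellBump t).integral_normed

theorem cellMass_eq_one (h : cell t ⊆ S) : cellMass t S = 1 := by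
  rw [cellMass, setIntegral_eq_integral_of_forall_compl_eq_zero, (cellBump t).integral_normed]
  rw [← support_cellBump_normed] at h
  exact fun x hx => Function.notMem_support.1 fun hx' => hx (h hx')

theorem cellMass_eq_zero (h : Disjoint (cell t) S) : cellMass t S = 0 := by
  rw [← support_cellBump_normed, Set.disjoint_right] at h
  exact setIntegral_eq_zero_of_forall_eq_zero fun x hx => Function.notMem_support.1 (h hx)

theorem cell_subset_Icc (t : Fin N) : cell t ⊆ Set.Icc 0 1 := by
  have hN : (0 : ℝ) < N := by exact_mod_cast t.pos
  have ht : (t + 1 : ℝ) ≤ N := by exact_mod_cast t.isLt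
  exact Set.Ioo_subset_Icc_self.trans
    (Set.Icc_subset_Icc (by positivity) ((div_le_one hN).2 ht))

theorem cell_subset_of_lt_of_lt {s u : Fin N} (hS : S.OrdConnected) (hs : ¬ Disjoint (cell s) S)
    (ht : ¬ Disjoint (cell t) S) (hsu : s < u) (hut : u < t) : cell u ⊆ S := by
  have hle : ∀ {v w : Fin N}, v < w → ((v : ℝ) + 1) / N ≤ w / N := fun {v w} hvw => by
    have hvw : (v : ℝ) + 1 ≤ w := by exact_mod_cast hvw
    gcongr
  obtain ⟨x, hxs, hx⟩ := Set.not_disjoint_iff.1 hs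
  obtain ⟨y, hyt, hy⟩ := Set.not_disjoint_iff.1 ht
  exact fun z hz => hS.out hx hy
    ⟨(hxs.2.le.trans (hle hsu)).trans hz.1.le, (hz.2.le.trans (hle hut)).trans hyt.1.le⟩

theorem isLayout_cells [NeZero N] {freeDisposal : Bool} :
    IsLayout freeDisposal (fun t : Fin N => (t : ℝ) / N) fun t => (t + 1) / N := by
  have h := isLayout_of_monotone (freeDisposal := freeDisposal)
    (s := fun t : Fin (N + 1) => (t : ℝ) / N)
    (fun t t' ht => div_le_div_of_nonneg_right (by exact_mod_cast ht) N.cast_nonneg) (by simp)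
    (by simp)
  simpa using h

end Cells

section OwnerInstance

variable {n N : ℕ} {g : Fin N → Fin n} {i : Fin n}

/-- The density that spreads a total value of `1` evenly over the cells `t` with `g t = i`. -/
def ownerDensity (g : Fin N → Fin n) (i : Fin n) (x : ℝ) : ℝ :=
  (∑ t with g t = i, (cellBump t).normed volume x) / #{t | g t = i}

theorem setIntegral_ownerDensity (g : Fin N → Fin n) (i : Fin n) (S : Set ℝ) :
    ∫ x in S, ownerDensity g i x = (∑ t with g t = i, cellMass t S) / #{t | g t = i} := by
  simp only [ownerDensity, integral_div]
  rw [integral_finsetSum _ fun t _ => (cellBump t).integrable_normed.integrableOn]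
  rfl

theorem setIntegral_ownerDensity_eq_one (hg : Function.Surjective g) {S : Set ℝ}
    (hS : ∀ t, g t = i → cell t ⊆ S) : ∫ x in S, ownerDensity g i x = 1 := by
  obtain ⟨t, ht⟩ := hg i
  have hcard : (#{t | g t = i} : ℝ) ≠ 0 :=
    Nat.cast_ne_zero.2 (card_ne_zero_of_mem ((mem_filter_univ t).2 ht))
  rw [setIntegral_ownerDensity,
    sum_congr rfl fun t ht => cellMass_eq_one (hS t ((mem_filter_univ t).1 ht)), sum_const,
    nsmul_one, div_self hcard]

/-- The instance in which player `i` values exactly the cells `t` with `g t = i`, all equally. -/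
def ownerInstance (g : Fin N → Fin n) (hg : Function.Surjective g) : Instance n where
  density := ownerDensity g
  continuousOn _ := ((continuous_finsetSum _ fun t _ =>
    (cellBump t).continuous_normed).div_const _).continuousOn
  nonneg _ x _ := div_nonneg (sum_nonneg fun t _ => (cellBump t).nonneg_normed x) (by positivity)
  normalized _ := setIntegral_ownerDensity_eq_one hg fun t _ => cell_subset_Icc t

theorem one_le_optEgalitarianF_ownerInstance [NeZero n] {freeDisposal : Bool} {k : ℕ}
    (hg : Function.Surjective g) (hk : ∀ j, #{t | g t = j} ≤ k) (hk₁ : 1 ≤ k) :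
    1 ≤ (ownerInstance g hg).optEgalitarianF freeDisposal k := by
  obtain ⟨t₀, -⟩ := hg 0
  have : NeZero N := ⟨t₀.pos.ne'⟩
  obtain ⟨A, hA, hcell, -⟩ := (isLayout_cells (freeDisposal := freeDisposal)).exists_isAllocation hk
  have hone : ∀ i, (ownerInstance g hg).value i (A i) = 1 := fun i =>
    setIntegral_ownerDensity_eq_one hg fun t ht => ht ▸ hcell t
  have hEF : A ∈ (ownerInstance g hg).allocationsF freeDisposal k :=
    ⟨hA, fun i j => (hA.portion j).value_le_one.trans_eq (hone i).symm⟩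
  exact (le_ciInf fun i => (hone i).ge).trans
    (((ownerInstance g hg).isGreatest_optEgalitarianF freeDisposal hk₁).2 ⟨A, hEF, rfl⟩)

theorem IsPortion.ordConnected {S : Set ℝ} (h : IsPortion 1 S) : S.OrdConnected := by
  obtain ⟨J, hJ, -, rfl⟩ := h
  rw [Set.iUnion_eq_const (s := J 0) fun m => by rw [Subsingleton.elim m 0]]
  exact (hJ 0).1

open Classical in
theorem value_ownerInstance_le (hg : Function.Surjective g) (S : Set ℝ) :
    (ownerInstance g hg).value i S ≤
      #{t | g t = i ∧ ¬ Disjoint (cell t) S} / #{t | g t = i} := by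
  refine (setIntegral_ownerDensity g i S).trans_le (div_le_div_of_nonneg_right ?_ (by positivity))
  calc ∑ t with g t = i, cellMass t S
      ≤ ∑ t with g t = i, if ¬ Disjoint (cell t) S then (1 : ℝ) else 0 := by
        refine sum_le_sum fun t _ => ?_
        split_ifs with h
        · exact (cellMass_eq_zero h).le
        · exact cellMass_le_one t S
    _ = #{t | g t = i ∧ ¬ Disjoint (cell t) S} := by rw [sum_boole, filter_filter]

theorem value_ownerInstance_eq_zero (hg : Function.Surjective g) {S : Set ℝ}
    (hS : ∀ t, g t = i → Disjoint (cell t) S) : (ownerInstance g hg).value i S = 0 := by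
  refine (setIntegral_ownerDensity g i S).trans ?_
  rw [sum_eq_zero fun t ht => cellMass_eq_zero (hS t ((mem_filter_univ t).1 ht)), zero_div]

/-- If the interval of player `i` meets two cells of player `i`, it swallows the only cell of
another player, whose value drops to `0`. -/
theorem optEgalitarianF_one_ownerInstance_le [NeZero n] (freeDisposal : Bool)
    (hg : Function.Surjective g) (hsep : ∀ s t, g s = i → g t = i → s < t →
      ∃ u, s < u ∧ u < t ∧ ∀ v, g v = g u → v = u) :
    (ownerInstance g hg).optEgalitarianF freeDisposal 1 ≤ 1 / #{t | g t = i} := by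
  classical
  set I := ownerInstance g hg
  obtain ⟨A, ⟨hA, -⟩, hopt⟩ := (I.isGreatest_optEgalitarianF freeDisposal le_rfl).1
  rw [← hopt]
  by_cases hmet : ∃ s t, g s = i ∧ g t = i ∧ s < t ∧ ¬ Disjoint (cell s) (A i) ∧
    ¬ Disjoint (cell t) (A i)
  · obtain ⟨s, t, hsi, hti, hst, hs, ht⟩ := hmet
    obtain ⟨u, hsu, hut, hu⟩ := hsep s t hsi hti hst
    have hui : g u ≠ i := fun hui => hsu.ne (hu s (hsi.trans hui.symm))
    have hsub : cell u ⊆ A i := cell_subset_of_lt_of_lt (hA.portion i).ordConnected hs ht hsu hut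
    have hzero : I.value (g u) (A (g u)) = 0 := value_ownerInstance_eq_zero hg fun v hv => by
      rw [hu v hv]
      exact (hA.disjoint i (g u) hui.symm).mono_left hsub
    exact ((I.egalitarianWelfare_le A (g u)).trans_eq hzero).trans (by positivity)
  · have hcard : #{t | g t = i ∧ ¬ Disjoint (cell t) (A i)} ≤ 1 := by
      refine card_le_one.2 fun s hs t ht => ?_
      obtain ⟨hsi, hs⟩ := (mem_filter_univ s).1 hs
      obtain ⟨hti, ht⟩ := (mem_filter_univ t).1 ht
      by_contra hst
      rcases lt_or_gt_of_ne hst with hst | hst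
      exacts [hmet ⟨s, t, hsi, hti, hst, hs, ht⟩, hmet ⟨t, s, hti, hsi, hst, ht, hs⟩]
    refine (I.egalitarianWelfare_le A i).trans ((value_ownerInstance_le hg _).trans ?_)
    gcongr
    exact_mod_cast hcard

end OwnerInstance

section AlternatingOwner

variable {m n : ℕ} (hmn : m ≤ n)

/-- The assignment `0, 1, 0, 2, 0, …, m - 1, 0, m, m + 1, …, n - 1` of players to cells, in which
any two of the `m` cells of player `0` are separated by the only cell of another player. -/
def alternatingOwner (t : Fin (n + m - 1)) : Fin n :=
  ⟨if (t : ℕ) < 2 * m - 1 then if (t : ℕ) % 2 = 0 then 0 else (t + 1) / 2 else t + 1 - m, by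
    split_ifs <;> omega⟩

theorem alternatingOwner_surjective (hm : 1 ≤ m) : Function.Surjective (alternatingOwner hmn) := by
  refine fun i => ⟨⟨if i < m then 2 * i - 1 else i + m - 1, by split_ifs <;> omega⟩, Fin.ext ?_⟩
  simp only [alternatingOwner]
  split_ifs <;> omega

variable {hmn}

theorem eq_of_alternatingOwner_eq {s t : Fin (n + m - 1)}
    (hs : (alternatingOwner hmn s : ℕ) ≠ 0)
    (h : alternatingOwner hmn t = alternatingOwner hmn s) : t = s := by
  rw [Fin.ext_iff] at h ⊢
  simp only [alternatingOwner] at hs h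
  split_ifs at hs h <;> omega

theorem alternatingOwner_eq_zero_iff [NeZero n] {t : Fin (n + m - 1)} :
    alternatingOwner hmn t = 0 ↔ ∃ j < m, 2 * j = (t : ℕ) := by
  rw [Fin.ext_iff, Fin.val_zero]
  simp only [alternatingOwner]
  constructor
  · intro h
    refine ⟨t / 2, ?_⟩
    split_ifs at h <;> omega
  · rintro ⟨j, hj, ht⟩
    split_ifs <;> omega

theorem card_alternatingOwner_eq_zero [NeZero n] :
    #{t | alternatingOwner hmn t = 0} = m := by
  rw [← card_map Fin.valEmbedding]
  trans #((range m).image (2 * ·))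
  · congr 1
    ext x
    simp only [alternatingOwner_eq_zero_iff, mem_map, mem_filter_univ, mem_image, mem_range]
    constructor
    · rintro ⟨t, ht, rfl⟩
      exact ht
    · rintro ⟨j, hj, rfl⟩
      exact ⟨⟨2 * j, by omega⟩, ⟨j, hj, rfl⟩, rfl⟩
  · rw [card_image_of_injective _ (mul_right_injective₀ two_ne_zero), card_range]

theorem card_alternatingOwner_eq_le [NeZero n] (hm : 1 ≤ m) (i : Fin n) :
    #{t | alternatingOwner hmn t = i} ≤ m := by
  rcases eq_or_ne i 0 with rfl | hi
  · exact card_alternatingOwner_eq_zero.le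
  · refine (card_le_one.2 fun s hs t ht => ?_).trans hm
    obtain rfl := (mem_filter_univ t).1 ht
    exact eq_of_alternatingOwner_eq (Fin.val_ne_zero_iff.2 hi) ((mem_filter_univ s).1 hs)

theorem exists_between_alternatingOwner [NeZero n] {s t : Fin (n + m - 1)}
    (hs : alternatingOwner hmn s = 0) (ht : alternatingOwner hmn t = 0) (hst : s < t) :
    ∃ u, s < u ∧ u < t ∧
      ∀ v, alternatingOwner hmn v = alternatingOwner hmn u → v = u := by
  obtain ⟨j, hj, hsj⟩ := alternatingOwner_eq_zero_iff.1 hs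
  obtain ⟨l, hl, htl⟩ := alternatingOwner_eq_zero_iff.1 ht
  rw [Fin.lt_def] at hst
  let u : Fin (n + m - 1) := ⟨s + 1, by omega⟩
  have hu : alternatingOwner hmn u ≠ 0 := fun hu => by
    obtain ⟨j', -, hj'⟩ := alternatingOwner_eq_zero_iff.1 hu
    simp only [u] at hj'
    omega
  refine ⟨u, Fin.lt_def.2 (Nat.lt_succ_self _), Fin.lt_def.2 ?_, fun v =>
    eq_of_alternatingOwner_eq (Fin.val_ne_zero_iff.2 hu)⟩
  simp only [u]
  omega

end AlternatingOwner

theorem exists_le_gainEF {m n k : ℕ} (hm : 1 ≤ m) (hmn : m ≤ n) (hmk : m ≤ k)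
    (freeDisposal : Bool) : ∃ I : Instance n, (m : ℝ) ≤ I.gainEF freeDisposal k := by
  have : NeZero n := ⟨by omega⟩
  have hm₀ : (m : ℝ) ≠ 0 := by exact_mod_cast (by omega : m ≠ 0)
  have hg := alternatingOwner_surjective hmn hm
  refine ⟨ownerInstance _ hg, ?_⟩
  rw [Instance.gainEF, le_div_iff₀ (Instance.optEgalitarianF_pos freeDisposal _ le_rfl)]
  calc m * (ownerInstance _ hg).optEgalitarianF freeDisposal 1
      ≤ m * (1 / m) := by
        gcongr
        refine (optEgalitarianF_one_ownerInstance_le (i := 0) freeDisposal hg fun s t =>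
          exists_between_alternatingOwner).trans_eq ?_
        rw [card_alternatingOwner_eq_zero]
    _ = 1 := mul_one_div_cancel hm₀
    _ ≤ (ownerInstance _ hg).optEgalitarianF freeDisposal k :=
        one_le_optEgalitarianF_ownerInstance hg
          (fun i => (card_alternatingOwner_eq_le hm i).trans hmk) (hm.trans hmk)
end CakeCutting

end
theorem theorem3p22 (freeDisposal : Bool) (n k : ℕ) (hn : 1 ≤ n) (hk : 1 ≤ k) :
    -- the maxima in the numerator and in the denominator of the gain exist, and no gain
    -- divides by zero
    (∀ I : CakeCutting.Instance n,
      IsGreatest (I.egalitarianWelfare '' I.allocationsF freeDisposal k)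
        (I.optEgalitarianF freeDisposal k) ∧
      IsGreatest (I.egalitarianWelfare '' I.allocationsF freeDisposal 1)
        (I.optEgalitarianF freeDisposal 1) ∧
      0 < I.optEgalitarianF freeDisposal 1) ∧
    -- the supremum over all instances is finite
    BddAbove (Set.range fun I : CakeCutting.Instance n => I.gainEF freeDisposal k) ∧
    (k ≤ n →
      (k : ℝ) ≤ CakeCutting.POIEf freeDisposal n k ∧
      ∃ I : CakeCutting.Instance n, (k : ℝ) ≤ I.gainEF freeDisposal k) ∧
    (n < k →
      CakeCutting.POIEf freeDisposal n k = n ∧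
      ∃ I : CakeCutting.Instance n, I.gainEF freeDisposal k = n) := by
  have : NeZero n := ⟨by omega⟩
  have hle : ∀ I : CakeCutting.Instance n, I.gainEF freeDisposal k ≤ n := fun I =>
    I.gainEF_le freeDisposal hk
  have hbdd : BddAbove (Set.range fun I : CakeCutting.Instance n => I.gainEF freeDisposal k) :=
    ⟨n, Set.forall_mem_range.2 hle⟩
  refine ⟨fun I => ⟨I.isGreatest_optEgalitarianF freeDisposal hk,
    I.isGreatest_optEgalitarianF freeDisposal le_rfl, I.optEgalitarianF_pos freeDisposal le_rfl⟩,
    hbdd, fun hkn => ?_, fun hnk => ?_⟩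
  · obtain ⟨I, hI⟩ := CakeCutting.exists_le_gainEF hk hkn le_rfl freeDisposal
    exact ⟨hI.trans (le_ciSup hbdd I), I, hI⟩
  · obtain ⟨I, hI⟩ := CakeCutting.exists_le_gainEF hn le_rfl hnk.le freeDisposal
    have : Nonempty (CakeCutting.Instance n) := ⟨I⟩
    exact ⟨le_antisymm (ciSup_le hle) (hI.trans (le_ciSup hbdd I)), I, le_antisymm (hle I) hI⟩
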